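/- Let $m,n\ge 1$, let $p\mid m$, and let $V$ be a complex vector space of dimension $n$ with a positive definite hermitian form and an orthonormal basis $e_1,\dots,e_n$. For a space $W$ with a basis $(w_i)_{i\in I}$, $|I|=b$, and for $q\mid m$, write $G(m,q,b)$ for the group of all linear maps $w_i\mapsto\theta(i)w_{\sigma(i)}$ with $\sigma\in\mathrm{Sym}(I)$, $\theta:I\to\boldsymbol\mu_m$ and $\prod_i\theta(i)^{m/q}=1$. Let $G=G(m,p,n)$ acting on $V$. Let $0\le n_0<n$, let $\lambda=(n_1\ge\dots\ge n_d)$ be a partition of $n-n_0$ into positive parts, and suppose that $n_0=0$ if $m=1$. Let $\Lambda_0=\{e_1,\dots,e_{n_0}\}$ and let $\Lambda_1,\dots,\Lambda_d$ be the consecutive blocks, of sizes $n_1,\dots,n_d$, of $e_{n_0+1},\dots,e_n$. The standard parabolic subgroup $P=P_{(n_0,\lambda)}$ is $G(m,p,n_0)\times\prod_{i=1}^d G(1,1,n_i)$, where the first factor acts on the span of $\Lambda_0$ (and is omitted if $n_0=0$) and the $i$th symmetric group $G(1,1,n_i)$ permutes $\Lambda_i$. Let $b_k$ be the number of $i\ge1$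 with $n_i=k$. For $b_k\neq0$ let $M_k$ be the span of the blocks $\Lambda_i$ ($i\ge 1$) of size $k$, and let $X_k=\mathrm{Fix}_{M_k}(P)$. Then: (i) $N_G(P)$ has a complement $H$ to $P$. Suppose moreover that it is not the case that both $n_0=1$ and $p=m$. Then $\mathrm{Fix}_V(P)=\bigoplus_{b_k\ne0}X_k$; the sums $\sum_{e\in\Lambda_i}e$ with $i\ge 1$ and $n_i=k$ form a basis of $X_k$, with respect to which groups $G(m,q,b_k)$ on $X_k$ are taken; and $\mathrm{Fix}_V(P)$ and the $X_k$ are invariant under $N_G(P)$. Let $\varphi_k:N_G(P)\to GL(X_k)$ be the restriction homomorphism. For every complement $H$ to $P$ in $N_G(P)$, let $H^\circ$ be the subgroup generated by the elements of $H$ that act as reflections on $\mathrm{Fix}_V(P)$. Then: (ii) If $n_0\neq0$, then $\varphi_k(H)=G(m,1,b_k)$ for all $k$ with $b_k\ne0$, and $H=H^\circ$ acts faithfully on $\mathrm{Fix}_V(P)=\bigoplus_k X_k$ as the reflection group $\prod_{k,\,b_k\neq0}G(m,1,b_k)$. (iii) If $n_0=0$, then, with $p_k=p/\gcd(p,k)$,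 $\varphi_k(H^\circ)=G(m,p_k,b_k)$ for all $k$ with $b_k\ne0$, and $H^\circ$ acts faithfully on $\mathrm{Fix}_V(P)$ as $\prod_{k,\,b_k\ne0}G(m,p_k,b_k)$. Furthermore, for every $k$ with $b_k\neq0$, $\varphi_k(H)=G(m,q_k,b_k)$ for some divisor $q_k$ of $p_k$. -/

import Mathlib

open scoped BigOperators

namespace ImprimitiveReflection

section General

variable {W : Type*} [AddCommGroup W] [Module ℂ W]

/-- The group `G(m,p,|ι|)` acting on a space with basis `b` indexed by `ι`: all `(σ;θ)`,
`b i ↦ θ(i) b (σ i)`, with `σ` a permutation of `ι`, `θ : ι → μ_m` and `∏ θ(i)^(m/p) = 1`. -/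
def monomialGroup {ι : Type*} [Fintype ι] (b : Module.Basis ι ℂ W) (m p : ℕ) :
    Subgroup (W ≃ₗ[ℂ] W) where
  carrier := {g | ∃ (σ : Equiv.Perm ι) (θ : ι → rootsOfUnity m ℂ),
    ∏ i, θ i ^ (m / p) = 1 ∧ ∀ i, g (b i) = ((θ i : ℂˣ) : ℂ) • b (σ i)}
  one_mem' := ⟨1, fun _ => 1, by simp, by simp⟩
  mul_mem' := by
    rintro g h ⟨σ, θ, hθ, hg⟩ ⟨τ, η, hη, hh⟩
    refine ⟨σ * τ, fun i => θ (τ i) * η i, ?_, fun i => ?_⟩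
    · simp only [mul_pow, Finset.prod_mul_distrib, hη, mul_one]
      rw [← hθ]
      exact Equiv.prod_comp τ (fun i => θ i ^ (m / p))
    · simp [hh, hg, smul_smul, mul_comm]
  inv_mem' := by
    rintro g ⟨σ, θ, hθ, hg⟩
    refine ⟨σ⁻¹, fun i => (θ (σ⁻¹ i))⁻¹, ?_, fun i => ?_⟩
    · simp only [inv_pow, Finset.prod_inv_distrib, inv_eq_one]
      rw [← hθ]
      exact Equiv.prod_comp σ⁻¹ (fun i => θ i ^ (m / p))
    · apply g.injective
      have h1 : g (g⁻¹ (b i)) = b i := by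
        rw [← LinearEquiv.mul_apply, mul_inv_cancel]; rfl
      rw [h1, map_smul, hg, smul_smul]
      simp

/-- The elements of `G(m,p,|ι|)` that fix every `b i` with `i ∉ S`: this is the group
`G(m,p,|S|)` acting on the span of `{b i | i ∈ S}` (and trivially on the other basis vectors). -/
def blockFactor {ι : Type*} [Fintype ι] (b : Module.Basis ι ℂ W) (m p : ℕ) (S : Set ι) :
    Subgroup (W ≃ₗ[ℂ] W) :=
  monomialGroup b m p ⊓
    { carrier := {g | ∀ i ∉ S, g (b i) = b i}
      one_mem' := fun _ _ => rfl
      mul_mem' := by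
        intro g h hg hh i hi
        rw [LinearEquiv.mul_apply, hh i hi, hg i hi]
      inv_mem' := by
        intro g hg i hi
        apply g.injective
        rw [← LinearEquiv.mul_apply, mul_inv_cancel, hg i hi]; rfl }

/-- The space `Fix_W(K)` of vectors fixed by every element of `K`. -/
def fixedSpace (K : Subgroup (W ≃ₗ[ℂ] W)) : Submodule ℂ W where
  carrier := {v | ∀ g ∈ K, g v = v}
  zero_mem' := fun g _ => map_zero g
  add_mem' := fun {v w} hv hw g hg => by rw [map_add, hv g hg, hw g hg]
  smul_mem' := fun c v hv g hg => by rw [map_smul, hv g hg]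

/-- The setwise stabiliser of a subspace. -/
def setStabilizer (U : Submodule ℂ W) : Subgroup (W ≃ₗ[ℂ] W) where
  carrier := {g | U.map (g : W →ₗ[ℂ] W) = U}
  one_mem' := Submodule.map_id U
  mul_mem' := by
    intro g h hg hh
    have : U.map ((g * h : W ≃ₗ[ℂ] W) : W →ₗ[ℂ] W) =
        (U.map (h : W →ₗ[ℂ] W)).map (g : W →ₗ[ℂ] W) := Submodule.map_comp _ _ U
    exact this.trans ((congrArg _ hh).trans hg)
  inv_mem' := by
    intro g hg
    have h1 : ((g⁻¹ : W ≃ₗ[ℂ] W) : W →ₗ[ℂ] W) ∘ₗ (g : W →ₗ[ℂ] W) = LinearMap.id :=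
      LinearMap.ext fun x => g.symm_apply_apply x
    have h2 := Submodule.map_comp (g : W →ₗ[ℂ] W) ((g⁻¹ : W ≃ₗ[ℂ] W) : W →ₗ[ℂ] W) U
    rw [h1, Submodule.map_id] at h2
    exact (congrArg _ hg).symm.trans h2.symm

/-- Restriction of the setwise stabiliser of `U` to `U`. -/
def restrictHom (U : Submodule ℂ W) : setStabilizer U →* (U ≃ₗ[ℂ] U) where
  toFun g := g.1.ofSubmodules U U g.2
  map_one' := rfl
  map_mul' _ _ := rfl

/-- The restriction homomorphism `N → GL(U)`, for a group `N` that leaves `U` invariant. -/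
def restriction {N : Subgroup (W ≃ₗ[ℂ] W)} {U : Submodule ℂ W} (h : N ≤ setStabilizer U) :
    N →* (U ≃ₗ[ℂ] U) :=
  (restrictHom U).comp (Subgroup.inclusion h)

/-- A reflection: finite order, and the space of fixed points is a hyperplane. -/
def IsReflection (g : W ≃ₗ[ℂ] W) : Prop :=
  IsOfFinOrder g ∧
    Module.finrank ℂ (fixedSpace (Subgroup.zpowers g)) + 1 = Module.finrank ℂ W

/-- For a group `N` acting on `W` through `ρ` and a subgroup `H` of `N`, the subgroup `H°` of `H`
generated by the elements of `H` that act as reflections on `W`. -/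
def reflectionPart {N : Type*} [Group N] (ρ : N →* (W ≃ₗ[ℂ] W)) (H : Subgroup N) : Subgroup N :=
  Subgroup.closure {h | h ∈ H ∧ IsReflection (ρ h)}

end General

section Standard

variable {V : Type*} [AddCommGroup V] [Module ℂ V] {n d : ℕ}

/-- `n₀ + n₁ + ⋯ + nᵢ`, where `nⱼ₊₁ = lam j`. -/
def partialSum (n₀ : ℕ) (lam : Fin d → ℕ) (i : ℕ) : ℕ :=
  n₀ + ∑ l : Fin d with l.val < i, lam l

/-- The set of indices of the initial block `Λ₀` (indices start at `0`). -/
def block₀ (n n₀ : ℕ) : Finset (Fin n) := {j | j.val < n₀}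

/-- The set of indices of the block `Λᵢ₊₁` of size `lam i`. -/
def block (n n₀ : ℕ) (lam : Fin d → ℕ) (i : Fin d) : Finset (Fin n) :=
  {j | partialSum n₀ lam i.val ≤ j.val ∧ j.val < partialSum n₀ lam (i.val + 1)}

/-- The standard parabolic subgroup of `G(m,p,n)` of type `(n₀, lam)`: the (internal direct)
product of `G(m,p,n₀)` on the span of `Λ₀` and of the symmetric groups `G(1,1,nᵢ)` on the
blocks `Λᵢ`. -/
def standardParabolic (e : Module.Basis (Fin n) ℂ V) (m p n₀ : ℕ) (lam : Fin d → ℕ) :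
    Subgroup (V ≃ₗ[ℂ] V) :=
  blockFactor e m p (block₀ n n₀) ⊔ ⨆ i : Fin d, blockFactor e 1 1 (block n n₀ lam i)

/-- The normaliser `N_G(P)`. -/
def normalizerIn (G P : Subgroup (V ≃ₗ[ℂ] V)) : Subgroup (V ≃ₗ[ℂ] V) :=
  G ⊓ Subgroup.normalizer P

/-- `M_k`: the span of the basis vectors in the blocks of size `k`. -/
def isotypicSpace (e : Module.Basis (Fin n) ℂ V) (n₀ : ℕ) (lam : Fin d → ℕ) (k : ℕ) :
    Submodule ℂ V :=
  Submodule.span ℂ {v | ∃ i, lam i = k ∧ ∃ j ∈ block n n₀ lam i, v = e j}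

/-- `X_k = Fix_{M_k}(P)`. -/
def isotypicFixed (e : Module.Basis (Fin n) ℂ V) (m p n₀ : ℕ) (lam : Fin d → ℕ) (k : ℕ) :
    Submodule ℂ V :=
  isotypicSpace e n₀ lam k ⊓ fixedSpace (standardParabolic e m p n₀ lam)

end Standard

end ImprimitiveReflection

/-!
The elements of `G(m,p,n)` are the monomial maps `e j ↦ θ j • e (σ j)` with a condition on
`∏ θ j`, and everything is expressed through the data `σ, θ`. The parabolic subgroup `P` consists
of the monomial maps for which `σ` preserves every block and `θ` is trivial outside the initial
block (`BlockSystem.mem_parabolic`). Unless its first factor is trivial on a line (`n₀ = 1` and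
`p = m`), its fixed space `U` has the block sums as a basis, so that an element of the normaliser
`N`, which preserves `U`, must permute the blocks and have constant coefficients `η` on each of them
(`BlockSystem.mem_normalizerIn`). Hence `N` acts on `U` by monomial maps, with kernel exactly `P`.

For the existence of a complement, enumerate each block and take the elements of `N` that respect
the enumerations and are trivial on the initial block, except for one coefficient there, chosen to
make the product of all coefficients `1` (`BlockSystem.exists_isComplement'`). If `n₀ = 1` and
`p = m`, then `P` is unchanged when the initial block is treated as one more block of size `1`.

As `P` is the kernel of the action on `U`, every complement `H` maps isomorphically onto the image
of `N`, so the remaining assertions concern that image only. If `n₀ ≠ 0`, it consists of all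
monomial maps of `U` that preserve the sizes of the blocks, because the initial block can absorb any
product of coefficients. If `n₀ = 0`, there is one equation, `(∏ η b ^ size b) ^ (m / p) = 1`.
A rank one argument shows that a monomial reflection is either diagonal with one nontrivial
coefficient `z`, or a transposition with inverse coefficients
(`IsReflection.monomialMap_cases`). On a block of size `k` and for `n₀ = 0`, the former means
`z ^ (k m / p) = 1`, that is, `z ∈ μ_{m/p_k}` with `p_k = p / gcd(p,k)`. These reflections
generate exactly the maps whose coefficients over the blocks of size `k` have product in
`μ_{m/p_k}` (`monomialMap_mem_of_reflections_mem`). Finally, the products of coefficients over the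
blocks of size `k` that occur in `H` form a subgroup of the cyclic group `μ_m` containing
`μ_{m/p_k}`, hence equal to `μ_{m/q}` for some `q ∣ p_k`.
-/

namespace ImprimitiveReflection

/-! ### Monomial maps -/

theorem rootsOfUnity_pow_self {m : ℕ} (z : rootsOfUnity m ℂ) : z ^ m = 1 :=
  Subtype.ext (by simpa using (mem_rootsOfUnity _ _).1 z.2)

section Monomial

variable {W : Type*} [AddCommGroup W] [Module ℂ W] {ι : Type*} {m : ℕ}

/-- The monomial map `b i ↦ θ i • b (σ i)`. -/
noncomputable def monomialMap (b : Module.Basis ι ℂ W) (σ : Equiv.Perm ι)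
    (θ : ι → rootsOfUnity m ℂ) : W ≃ₗ[ℂ] W :=
  b.equiv (b.unitsSMul fun i => (θ (σ.symm i) : ℂˣ)) σ

variable (b : Module.Basis ι ℂ W)

@[simp]
theorem monomialMap_apply (σ : Equiv.Perm ι) (θ : ι → rootsOfUnity m ℂ) (i : ι) :
    monomialMap b σ θ (b i) = ((θ i : ℂˣ) : ℂ) • b (σ i) := by
  simp [monomialMap, Module.Basis.unitsSMul_apply, Units.smul_def]

theorem eq_monomialMap {g : W ≃ₗ[ℂ] W} {σ : Equiv.Perm ι} {θ : ι → rootsOfUnity m ℂ}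
    (h : ∀ i, g (b i) = ((θ i : ℂˣ) : ℂ) • b (σ i)) : g = monomialMap b σ θ :=
  LinearEquiv.toLinearMap_injective (b.ext fun i => by simp [h])

theorem monomialMap_mul (σ τ : Equiv.Perm ι) (θ η : ι → rootsOfUnity m ℂ) :
    monomialMap b σ θ * monomialMap b τ η =
      monomialMap b (σ * τ) (fun i => θ (τ i) * η i) :=
  eq_monomialMap b fun i => by simp [smul_smul, mul_comm]

theorem monomialMap_one : monomialMap b 1 (1 : ι → rootsOfUnity m ℂ) = 1 :=
  (eq_monomialMap b fun i => by simp).symm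

theorem monomialMap_inv (σ : Equiv.Perm ι) (θ : ι → rootsOfUnity m ℂ) :
    (monomialMap b σ θ)⁻¹ = monomialMap b σ⁻¹ (fun i => (θ (σ⁻¹ i))⁻¹) := by
  rw [inv_eq_iff_mul_eq_one, monomialMap_mul, ← monomialMap_one (m := m) b]
  congr 1
  · simp
  · funext i; simp

theorem monomialMap_inj {σ τ : Equiv.Perm ι} {θ η : ι → rootsOfUnity m ℂ} :
    monomialMap b σ θ = monomialMap b τ η ↔ σ = τ ∧ θ = η := by
  refine ⟨fun h => ?_, fun h => by rw [h.1, h.2]⟩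
  have key : ∀ i, σ i = τ i ∧ θ i = η i := fun i => by
    have h1 := congrArg b.repr (LinearEquiv.congr_fun h (b i))
    simp only [monomialMap_apply, map_smul, Module.Basis.repr_self, Finsupp.smul_single,
      smul_eq_mul, mul_one] at h1
    rcases Finsupp.single_eq_single_iff _ _ _ _ |>.1 h1 with ⟨h2, h3⟩ | ⟨h2, -⟩
    · exact ⟨h2, Subtype.ext (Units.ext h3)⟩
    · exact absurd h2 (Units.ne_zero _)
  exact ⟨Equiv.ext fun i => (key i).1, funext fun i => (key i).2⟩

theorem monomialMap_repr (σ : Equiv.Perm ι) (θ : ι → rootsOfUnity m ℂ) (v : W) (i : ι) :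
    b.repr (monomialMap b σ θ v) (σ i) = ((θ i : ℂˣ) : ℂ) * b.repr v i := by
  classical
  refine LinearMap.congr_fun (f := b.coord (σ i) ∘ₗ (monomialMap b σ θ).toLinearMap)
    (g := ((θ i : ℂˣ) : ℂ) • b.coord i) (b.ext fun j => ?_) v
  simp only [LinearMap.comp_apply, LinearEquiv.coe_coe, monomialMap_apply, map_smul,
    LinearMap.smul_apply, Module.Basis.coord_apply, Module.Basis.repr_self,
    Finsupp.single_apply, EmbeddingLike.apply_eq_iff_eq]
  split_ifs with h <;> simp [h]

variable [Fintype ι]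

theorem mem_monomialGroup {p : ℕ} {g : W ≃ₗ[ℂ] W} :
    g ∈ monomialGroup b m p ↔ ∃ (σ : Equiv.Perm ι) (θ : ι → rootsOfUnity m ℂ),
      (∏ i, θ i) ^ (m / p) = 1 ∧ g = monomialMap b σ θ := by
  constructor
  · rintro ⟨σ, θ, h, hg⟩
    exact ⟨σ, θ, by rwa [← Finset.prod_pow], eq_monomialMap b hg⟩
  · rintro ⟨σ, θ, h, rfl⟩
    exact ⟨σ, θ, by rwa [Finset.prod_pow], fun i => monomialMap_apply b σ θ i⟩

theorem isOfFinOrder_monomialMap [NeZero m] (σ : Equiv.Perm ι) (θ : ι → rootsOfUnity m ℂ) :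
    IsOfFinOrder (monomialMap b σ θ) := by
  have hfin : Finite (monomialGroup b m 1) := by
    refine Set.Finite.subset (Set.finite_range
      fun x : Equiv.Perm ι × (ι → rootsOfUnity m ℂ) => monomialMap b x.1 x.2) ?_
    intro g hg
    obtain ⟨σ, θ, -, rfl⟩ := (mem_monomialGroup b).1 hg
    exact ⟨(σ, θ), rfl⟩
  have h : monomialMap b σ θ ∈ monomialGroup b m 1 :=
    (mem_monomialGroup b).2 ⟨σ, θ, by
      rw [Nat.div_one, rootsOfUnity_pow_self], rfl⟩
  exact Submonoid.isOfFinOrder_coe.2 (isOfFinOrder_of_finite (⟨_, h⟩ : monomialGroup b m 1))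

end Monomial

/-! ### Permutations preserving a labelling -/

/-- A permutation that preserves the fibres of `s` is a product of transpositions that do so. -/
theorem perm_induction_of_fiber {α β : Type*} [Fintype α] [DecidableEq α] (s : α → β)
    {C : Equiv.Perm α → Prop} (one : C 1)
    (swap_mul : ∀ a b τ, a ≠ b → s a = s b → C τ → C (Equiv.swap a b * τ))
    (τ : Equiv.Perm α) (h : ∀ a, s (τ a) = s a) : C τ := by
  induction hn : τ.support.card using Nat.strong_induction_on generalizing τ with
  | _ n ih =>
    by_cases h1 : τ = 1
    · rwa [h1]
    obtain ⟨a, ha⟩ : ∃ a, τ a ≠ a := by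
      by_contra! hc
      exact h1 (Equiv.ext hc)
    have hlt := Equiv.Perm.card_support_swap_mul ha
    have := swap_mul a (τ a) (Equiv.swap a (τ a) * τ) (Ne.symm ha) (h a).symm
      (ih _ (hn ▸ hlt) _ (fun x => ?_) rfl)
    · rwa [← mul_assoc, Equiv.swap_mul_self, one_mul] at this
    · rw [Equiv.Perm.mul_apply, Equiv.swap_apply_def]
      split_ifs with h2 h3
      · rw [h, ← h2, h]
      · rw [← h a, ← h3]
        exact h x
      · exact h x

/-! ### Reflections among monomial maps -/

section Reflection

variable {W : Type*} [AddCommGroup W] [Module ℂ W]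

theorem fixedSpace_zpowers (g : W ≃ₗ[ℂ] W) :
    fixedSpace (Subgroup.zpowers g) = LinearMap.ker ((g : W →ₗ[ℂ] W) - LinearMap.id) := by
  ext v
  rw [LinearMap.mem_ker, LinearMap.sub_apply, sub_eq_zero]
  refine ⟨fun h => h g (Subgroup.mem_zpowers g), fun h => ?_⟩
  let S : Subgroup (W ≃ₗ[ℂ] W) := MulAction.stabilizer (W ≃ₗ[ℂ] W) v
  have hg : g ∈ S := h
  exact fun x hx => (Subgroup.zpowers_le.2 hg) hx

/-- `g` has a hyperplane of fixed points if and only if `g - 1` has rank one. -/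
theorem isReflection_iff [Module.Finite ℂ W] (g : W ≃ₗ[ℂ] W) :
    IsReflection g ↔ IsOfFinOrder g ∧
      Module.finrank ℂ (LinearMap.range ((g : W →ₗ[ℂ] W) - LinearMap.id)) = 1 := by
  rw [IsReflection, fixedSpace_zpowers]
  have := LinearMap.finrank_range_add_finrank_ker ((g : W →ₗ[ℂ] W) - LinearMap.id)
  refine and_congr_right fun _ => ?_
  omega

variable {B : Type*} [Fintype B] {m : ℕ} (F : Module.Basis B ℂ W)

theorem isReflection_monomialMap [NeZero m] {τ : Equiv.Perm B} {η : B → rootsOfUnity m ℂ} {v : W}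
    (hv : v ≠ 0) (i₀ : B) (h₀ : monomialMap F τ η (F i₀) - F i₀ = v)
    (h : ∀ i, monomialMap F τ η (F i) - F i ∈ Submodule.span ℂ {v}) :
    IsReflection (monomialMap F τ η) := by
  have := F.finiteDimensional_of_finite
  refine (isReflection_iff _).2 ⟨isOfFinOrder_monomialMap F τ η, ?_⟩
  suffices heq : LinearMap.range ((monomialMap F τ η : W →ₗ[ℂ] W) - LinearMap.id) =
      Submodule.span ℂ {v} by rw [heq, finrank_span_singleton hv]
  apply le_antisymm
  · rw [LinearMap.range_eq_map, ← F.span_eq, Submodule.map_span, Submodule.span_le]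
    rintro _ ⟨_, ⟨i, rfl⟩, rfl⟩
    exact h i
  · rw [Submodule.span_singleton_le_iff_mem]
    exact ⟨F i₀, h₀⟩

variable [DecidableEq B]

theorem isReflection_diagonal [NeZero m] (a : B) {z : rootsOfUnity m ℂ} (hz : z ≠ 1) :
    IsReflection (monomialMap F 1 (Pi.mulSingle a z)) := by
  have hz' : ((z : ℂˣ) : ℂ) - 1 ≠ 0 := fun h => hz (Subtype.ext (Units.ext (sub_eq_zero.1 h)))
  refine isReflection_monomialMap F (v := (((z : ℂˣ) : ℂ) - 1) • F a)
    (smul_ne_zero hz' (F.ne_zero a)) a (by simp [sub_smul]) fun i => ?_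
  by_cases hi : i = a
  · subst hi
    rw [monomialMap_apply]
    refine Submodule.mem_span_singleton.2 ⟨1, ?_⟩
    simp [sub_smul]
  · rw [monomialMap_apply, Pi.mulSingle_eq_of_ne hi]
    simp

theorem isReflection_swap [NeZero m] {a b : B} (hab : a ≠ b) (z : rootsOfUnity m ℂ) :
    IsReflection
      (monomialMap F (Equiv.swap a b) (Pi.mulSingle a z * Pi.mulSingle b z⁻¹)) := by
  refine isReflection_monomialMap F (v := ((z : ℂˣ) : ℂ) • F b - F a) ?_ a ?_ fun i => ?_
  · intro h
    have := congrArg (fun x => F.repr x a) h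
    simp [hab.symm] at this
  · simp [hab]
  · rw [monomialMap_apply]
    by_cases hi : i = a
    · subst hi
      refine Submodule.mem_span_singleton.2 ⟨1, ?_⟩
      simp [hab]
    by_cases hi' : i = b
    · subst hi'
      refine Submodule.mem_span_singleton.2 ⟨-((z : ℂˣ) : ℂ)⁻¹, ?_⟩
      simp [hi, smul_smul, sub_eq_add_neg, add_comm]
    · simp [hi, hi', Equiv.swap_apply_of_ne_of_ne hi hi']

/-- A monomial reflection is either diagonal with a single nontrivial entry, or a transposition
of two basis vectors up to scalars with product `1`. Both cases are read off the rank one matrix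
of `g - 1`. -/
theorem IsReflection.monomialMap_cases {τ : Equiv.Perm B} {η : B → rootsOfUnity m ℂ}
    (h : IsReflection (monomialMap F τ η)) :
    (∃ a, ∀ x, x ≠ a → η x = 1) ∨
      ∃ a, τ a ≠ a ∧ η a * η (τ a) = 1 ∧ ∀ x, x ≠ a → x ≠ τ a → η x = 1 := by
  have := F.finiteDimensional_of_finite
  obtain ⟨⟨v, hv⟩, hv0, hspan⟩ := finrank_eq_one_iff'.1 ((isReflection_iff _).1 h).2
  -- The matrix of `g - 1` is the product of the column `y` and the row `l`.
  obtain ⟨y, l, hM⟩ : ∃ y l : B → ℂ, ∀ i j,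
      (if τ j = i then (((η j : ℂˣ) : ℂ)) else 0) - (if j = i then 1 else 0) = l j * y i := by
    have : ∀ j, ∃ c : ℂ, c • v = monomialMap F τ η (F j) - F j := fun j => by
      obtain ⟨c, hc⟩ := hspan ⟨_, ⟨F j, rfl⟩⟩
      exact ⟨c, congrArg Subtype.val hc⟩
    choose l hl using this
    refine ⟨fun i => F.repr v i, l, fun i j => ?_⟩
    have := congrArg (fun x => F.repr x i) (hl j)
    simp only [monomialMap_apply, map_smul, map_sub, Module.Basis.repr_self,
      Finsupp.smul_apply, Finsupp.sub_apply, Finsupp.single_apply, smul_eq_mul] at this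
    rw [this]
    simp
  have one_of : ∀ x, y x = 0 → η x = 1 := fun x hx => by
    have h1 := hM x x
    rw [hx, mul_zero, if_pos rfl, sub_eq_zero] at h1
    split_ifs at h1
    · exact Subtype.ext (Units.ext h1)
    · exact absurd h1 zero_ne_one
  by_cases hτ : ∃ a, τ a ≠ a
  · obtain ⟨a, ha⟩ := hτ
    right
    have haa := hM a a
    have hla : l a ≠ 0 := fun h0 => by simp [h0, ha] at haa
    refine ⟨a, ha, ?_, fun x hx hx' => one_of x ?_⟩
    · have h1 := hM (τ a) a
      have h2 := hM a (τ a)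
      have h3 := hM (τ a) (τ a)
      have hne : τ (τ a) ≠ τ a := fun h => ha (τ.injective h)
      rw [if_neg ha, if_pos rfl] at haa
      rw [if_pos rfl, if_neg ha.symm] at h1
      rw [if_neg ha] at h2
      rw [if_neg hne, if_pos rfl] at h3
      have h4 : l a * y (τ a) * (l (τ a) * y a) = 1 := by
        linear_combination (-(l (τ a) * y (τ a))) * haa + h3
      rw [← h1, ← h2] at h4
      split_ifs at h4 with h5
      · refine Subtype.ext (Units.ext ?_)
        simpa using h4
      · simp at h4
    · have h1 := hM x a
      rw [if_neg hx'.symm, if_neg hx.symm, sub_zero] at h1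
      exact (mul_eq_zero.1 h1.symm).resolve_left hla
  · left
    push Not at hτ
    by_cases hη : ∃ a, η a ≠ 1
    · obtain ⟨a, ha⟩ := hη
      refine ⟨a, fun x hx => one_of x ?_⟩
      have haa := hM a a
      have h1 := hM x a
      rw [hτ, if_neg hx.symm, if_neg hx.symm, sub_zero] at h1
      rw [hτ, if_pos rfl, if_pos rfl] at haa
      have hla : l a ≠ 0 := fun h0 => ha (Subtype.ext (Units.ext (by
        simpa [h0, sub_eq_zero] using haa)))
      exact (mul_eq_zero.1 h1.symm).resolve_left hla
    · push Not at hη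
      by_cases hB : Nonempty B
      · exact ⟨hB.some, fun x _ => hη x⟩
      · have : IsEmpty B := not_nonempty_iff.1 hB
        exact absurd (Subtype.ext (F.ext_elem fun i => isEmptyElim i)) hv0

end Reflection

/-! ### Generation by reflections -/

section Generation

variable {W : Type*} [AddCommGroup W] [Module ℂ W] {B : Type*} [Fintype B] [DecidableEq B]
  {m : ℕ} (F : Module.Basis B ℂ W) {κ : Type*} [DecidableEq κ]

theorem prod_fiber_mulSingle (s : B → κ) (k : κ) (a : B) (z : rootsOfUnity m ℂ) :
    ∏ x with s x = k, (Pi.mulSingle a z : B → rootsOfUnity m ℂ) x = if s a = k then z else 1 := by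
  rw [Finset.prod_pi_mulSingle']
  simp

theorem prod_fiber_mulSingle_mul (s : B → κ) (k : κ) {a b : B} (h : s a = s b)
    (z : rootsOfUnity m ℂ) :
    ∏ x with s x = k,
      (Pi.mulSingle a z * Pi.mulSingle b z⁻¹ : B → rootsOfUnity m ℂ) x = 1 := by
  simp only [Pi.mul_apply, Finset.prod_mul_distrib, prod_fiber_mulSingle, h]
  split_ifs <;> simp

/-- Let `s` label the basis vectors. The monomial maps preserving the labels, whose coefficients
over the label `k` have product in `μ_{t k}`, are generated by reflections: permutations are
products of transpositions, and a diagonal map is reduced, by products of two reflections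
over the same transposition, to one with at most one nontrivial entry per label. -/
theorem monomialMap_mem_of_reflections_mem [NeZero m] (s : B → κ) (t : κ → ℕ) (K : Subgroup (W ≃ₗ[ℂ] W))
    (hK : ∀ (τ : Equiv.Perm B) (η : B → rootsOfUnity m ℂ), (∀ x, s (τ x) = s x) →
      (∀ k, (∏ x with s x = k, η x) ^ t k = 1) → IsReflection (monomialMap F τ η) →
      monomialMap F τ η ∈ K)
    (τ : Equiv.Perm B) (η : B → rootsOfUnity m ℂ) (hτ : ∀ x, s (τ x) = s x)
    (hη : ∀ k, (∏ x with s x = k, η x) ^ t k = 1) : monomialMap F τ η ∈ K := by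
  have hswap : ∀ {a b : B}, a ≠ b → s a = s b → ∀ z : rootsOfUnity m ℂ,
      monomialMap F (Equiv.swap a b) (Pi.mulSingle a z * Pi.mulSingle b z⁻¹) ∈ K := by
    intro a b hab hs z
    refine hK _ _ (fun x => ?_) (fun k => ?_) (isReflection_swap F hab z)
    · rw [Equiv.swap_apply_def]
      split_ifs with h1 h2
      · rw [h1, hs]
      · rw [h2, hs]
      · rfl
    · rw [prod_fiber_mulSingle_mul s k hs, one_pow]
  have hperm : monomialMap F τ (1 : B → rootsOfUnity m ℂ) ∈ K := by
    refine perm_induction_of_fiber s (C := fun τ => monomialMap F τ (1 : B → rootsOfUnity m ℂ) ∈ K)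
      ?_ (fun a b τ hab hs h => ?_) τ hτ
    · rw [monomialMap_one]
      exact K.one_mem
    · have := K.mul_mem (hswap hab hs 1) h
      rw [monomialMap_mul] at this
      convert this using 2
      funext i
      simp
  have hdiag : monomialMap F 1 η ∈ K := by
    clear hperm hτ
    induction hn : (Finset.univ.filter fun x => η x ≠ 1).card using Nat.strong_induction_on
      generalizing η with
    | _ n ih =>
    subst hn
    by_cases h1 : ∀ x, η x = 1
    · rw [show η = 1 from funext h1, monomialMap_one]
      exact K.one_mem
    push Not at h1
    obtain ⟨a, ha⟩ := h1
    -- Clearing the entry at `a` without creating new nontrivial entries.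
    have step : ∀ δ : B → rootsOfUnity m ℂ, (∀ k, (∏ x with s x = k, δ x) ^ t k = 1) →
        δ a = η a → (∀ x, η x = 1 → δ x = 1) → monomialMap F 1 δ ∈ K → monomialMap F 1 η ∈ K := by
      intro δ hδ hδa hδ1 hδK
      have := K.mul_mem (ih _ ?_ (η * δ⁻¹) (fun k => ?_) rfl) hδK
      · rw [monomialMap_mul, mul_one] at this
        convert this using 2
        funext i
        simp
      · refine Finset.card_lt_card (Finset.ssubset_iff_of_subset ?_ |>.2 ⟨a, ?_, ?_⟩)
        · intro x hx
          simp only [Finset.mem_filter, Finset.mem_univ, true_and] at hx ⊢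
          exact fun h => hx (by simp [h, hδ1 x h])
        · simpa using ha
        · simp [hδa]
      · simp only [Pi.mul_apply, Pi.inv_apply, Finset.prod_mul_distrib, Finset.prod_inv_distrib,
          mul_pow, inv_pow, hη, hδ, inv_one, mul_one]
    by_cases hb : ∃ b, b ≠ a ∧ s b = s a ∧ η b ≠ 1
    · obtain ⟨b, hba, hs, hb⟩ := hb
      refine step (Pi.mulSingle a (η a) * Pi.mulSingle b (η a)⁻¹)
        (fun k => by rw [prod_fiber_mulSingle_mul s k hs.symm, one_pow]) (by simp [hba.symm]) ?_ ?_
      · intro x hx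
        have hxa : x ≠ a := fun h => ha (h ▸ hx)
        have hxb : x ≠ b := fun h => hb (h ▸ hx)
        simp [hxa, hxb]
      · have := K.mul_mem (hswap hba hs (η a)) (hswap hba hs 1)
        rw [monomialMap_mul, Equiv.swap_mul_self] at this
        convert this using 2
        funext i
        by_cases hia : i = a
        · subst hia
          simp [hba, hba.symm]
        by_cases hib : i = b
        · subst hib
          simp [hba, hba.symm]
        simp [hia, hib, Equiv.swap_apply_of_ne_of_ne hib hia]
    · push Not at hb
      have hprod : ∏ x with s x = s a, η x = η a :=
        Finset.prod_eq_single_of_mem a (by simp) fun x hx hxa =>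
          hb x hxa (by simpa using hx)
      have hcond : ∀ k, (∏ x with s x = k,
          (Pi.mulSingle a (η a) : B → rootsOfUnity m ℂ) x) ^ t k = 1 := by
        intro k
        rw [prod_fiber_mulSingle]
        split_ifs with h
        · rw [← h, ← hprod, hη]
        · exact one_pow _
      refine step (Pi.mulSingle a (η a)) hcond (by simp) ?_
        (hK _ _ (fun _ => rfl) hcond (isReflection_diagonal F a ha))
      intro x hx
      have hxa : x ≠ a := fun h => ha (h ▸ hx)
      simp [hxa]
  have := K.mul_mem hperm hdiag
  rw [monomialMap_mul] at this
  simpa using this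

/-- The coefficients of a monomial reflection that preserves the labels `s`: over each label they
have product `1`, unless all but one of them are trivial. -/
theorem IsReflection.prod_fiber {s : B → κ} {τ : Equiv.Perm B} {η : B → rootsOfUnity m ℂ}
    (h : IsReflection (monomialMap F τ η)) (hτ : ∀ x, s (τ x) = s x) :
    (∃ a, ∀ x, x ≠ a → η x = 1) ∨ ∀ k, ∏ x with s x = k, η x = 1 := by
  obtain h | ⟨a, ha, hprod, hx⟩ := h.monomialMap_cases
  · exact Or.inl h
  right
  have : η = Pi.mulSingle a (η a) * Pi.mulSingle (τ a) (η a)⁻¹ := by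
    funext x
    by_cases hxa : x = a
    · subst hxa
      simp [ha.symm]
    by_cases hxb : x = τ a
    · subst hxb
      simpa [ha] using eq_inv_of_mul_eq_one_right hprod
    simp [hxa, hxb, hx x hxa hxb]
  intro k
  rw [this]
  exact prod_fiber_mulSingle_mul s k (hτ a).symm _

end Generation

/-! ### Arithmetic of the exponents -/

theorem div_div_gcd {m p : ℕ} (hm : 0 < m) (hp : p ∣ m) (k : ℕ) :
    m / (p / p.gcd k) = m / p * p.gcd k := by
  have hp0 : 0 < p := Nat.pos_of_dvd_of_pos hp hm
  obtain ⟨q, rfl⟩ := hp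
  obtain ⟨r, hr⟩ := Nat.gcd_dvd_left p k
  have hg : 0 < p.gcd k := Nat.gcd_pos_of_pos_left k hp0
  have hr0 : 0 < r := by
    rcases Nat.eq_zero_or_pos r with h | h
    · rw [h, mul_zero] at hr; omega
    · exact h
  have h1 : p / p.gcd k = r := by
    nth_rw 1 [hr]
    exact Nat.mul_div_cancel_left r hg
  rw [h1, Nat.mul_div_cancel_left q hp0]
  nth_rw 1 [hr]
  rw [show p.gcd k * r * q = r * (q * p.gcd k) by ring, Nat.mul_div_cancel_left _ hr0]

/-- In `μ_m`, the equation `z ^ (k m / p) = 1` defines `μ_{m/p'}`, where `p' = p / gcd(p,k)`. -/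
theorem rootsOfUnity_pow_eq_one_iff {m p : ℕ} (hm : 0 < m) (hp : p ∣ m) (k : ℕ)
    (z : rootsOfUnity m ℂ) :
    z ^ (m / (p / p.gcd k)) = 1 ↔ z ^ (k * (m / p)) = 1 := by
  rw [div_div_gcd hm hp]
  have h1 : (k * (m / p)).gcd m = m / p * p.gcd k := by
    nth_rw 2 [← Nat.div_mul_cancel hp]
    rw [mul_comm k, Nat.gcd_mul_left, Nat.gcd_comm]
  rw [← h1, ← orderOf_dvd_iff_pow_eq_one, ← orderOf_dvd_iff_pow_eq_one, Nat.dvd_gcd_iff]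
  exact and_iff_left (orderOf_dvd_of_pow_eq_one (rootsOfUnity_pow_self z))

theorem exists_rootsOfUnity_orderOf_eq (m : ℕ) [NeZero m] :
    ∃ u : rootsOfUnity m ℂ, orderOf u = m := by
  obtain ⟨u, hu⟩ := IsCyclic.exists_generator (α := rootsOfUnity m ℂ)
  exact ⟨u, by rw [orderOf_eq_card_of_forall_mem_zpowers hu, Complex.card_rootsOfUnity]⟩

/-- The subgroups of `μ_m` are the groups `μ_{m/q}` with `q ∣ m`; those that contain `μ_{m/r}`
have `q ∣ r`. -/
theorem exists_dvd_mem_iff_pow_eq_one {m r : ℕ} [NeZero m] (hr : r ∣ m)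
    (A : Subgroup (rootsOfUnity m ℂ)) (hA : ∀ z, z ^ (m / r) = 1 → z ∈ A) :
    ∃ q, q ∣ r ∧ ∀ z, z ∈ A ↔ z ^ (m / q) = 1 := by
  have hm : 0 < m := Nat.pos_of_neZero m
  let _ : Fintype (rootsOfUnity m ℂ) := Fintype.ofFinite _
  have ham : Nat.card A ∣ m := by
    have := A.card_subgroup_dvd_card
    rwa [Complex.card_rootsOfUnity] at this
  obtain ⟨u, hou⟩ := exists_rootsOfUnity_orderOf_eq m
  have ha0 : 0 < Nat.card A := Nat.card_pos
  have hr0 : 0 < r := Nat.pos_of_dvd_of_pos hr hm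
  have h1 : m / r ∣ Nat.card A := by
    have hmem : u ^ r ∈ A := hA _ (by rw [← pow_mul, Nat.mul_div_cancel' hr, rootsOfUnity_pow_self])
    have h2 : orderOf (u ^ r) = m / r := by
      rw [orderOf_pow_of_dvd hr0.ne' (hou.symm ▸ hr), hou]
    have h3 := orderOf_dvd_natCard (⟨u ^ r, hmem⟩ : A)
    rwa [Subgroup.orderOf_mk, h2] at h3
  refine ⟨m / Nat.card A, ?_, fun z => ?_⟩
  · obtain ⟨c, hc⟩ := h1
    refine ⟨c, ?_⟩
    have h4 : m / Nat.card A * Nat.card A = m := Nat.div_mul_cancel ham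
    have h5 : m / r * r = m := Nat.div_mul_cancel hr
    have h6 : 0 < m / r := Nat.div_pos (Nat.le_of_dvd hm hr) hr0
    apply Nat.eq_of_mul_eq_mul_left h6
    calc m / r * r = m / Nat.card A * Nat.card A := by rw [h4, h5]
      _ = m / Nat.card A * (m / r * c) := congrArg _ hc
      _ = m / r * (m / Nat.card A * c) := by ring
  · rw [Nat.div_div_self ham hm.ne']
    have hset : (A : Set (rootsOfUnity m ℂ)) = {z | z ^ Nat.card A = 1} := by
      classical
      refine Set.eq_of_subset_of_ncard_le (fun z hz => ?_) ?_ (Set.toFinite _)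
      · have := pow_card_eq_one' (x := (⟨z, hz⟩ : A))
        exact congrArg Subtype.val this
      · have h2 := IsCyclic.card_pow_eq_one_le (α := rootsOfUnity m ℂ) ha0
        rw [← Set.ncard_coe_finset] at h2
        simp only [Finset.coe_filter, Finset.mem_univ, true_and] at h2
        exact h2
    exact Set.ext_iff.1 hset z

/-! ### Block systems and their parabolic subgroups -/

theorem mem_blockFactor {W : Type*} [AddCommGroup W] [Module ℂ W] {ι : Type*} [Fintype ι]
    {b : Module.Basis ι ℂ W} {m p : ℕ} {S : Set ι} {g : W ≃ₗ[ℂ] W} :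
    g ∈ blockFactor b m p S ↔ ∃ (σ : Equiv.Perm ι) (θ : ι → rootsOfUnity m ℂ),
      (∏ i, θ i) ^ (m / p) = 1 ∧ (∀ i, i ∉ S → σ i = i ∧ θ i = 1) ∧ g = monomialMap b σ θ := by
  have key : ∀ (σ : Equiv.Perm ι) (θ : ι → rootsOfUnity m ℂ) (i : ι),
      monomialMap b σ θ (b i) = b i ↔ σ i = i ∧ θ i = 1 := fun σ θ i => by
    refine ⟨fun h => ?_, fun h => by simp [h.1, h.2]⟩
    have h1 := congrArg b.repr h
    simp only [monomialMap_apply, map_smul, Module.Basis.repr_self, Finsupp.smul_single,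
      smul_eq_mul, mul_one] at h1
    rcases Finsupp.single_eq_single_iff _ _ _ _ |>.1 h1 with ⟨h2, h3⟩ | ⟨h2, -⟩
    · exact ⟨h2, Subtype.ext (Units.ext h3)⟩
    · exact absurd h2 (Units.ne_zero _)
  constructor
  · rintro ⟨h1, h2⟩
    obtain ⟨σ, θ, h, rfl⟩ := (mem_monomialGroup b).1 h1
    exact ⟨σ, θ, h, fun i hi => (key σ θ i).1 (h2 i hi), rfl⟩
  · rintro ⟨σ, θ, h, h2, rfl⟩
    exact ⟨(mem_monomialGroup b).2 ⟨σ, θ, h, rfl⟩, fun i hi => (key σ θ i).2 (h2 i hi)⟩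

/-- A partition of `ι` into an initial part (label `none`, possibly empty) and nonempty blocks
labelled by `B`, together with an enumeration of each block: `pos` restricts to a bijection from
the block `b` to `{0, …, size b - 1}`. -/
structure BlockSystem (ι B : Type*) where
  init : Finset ι
  block : B → Finset ι
  label : ι → Option B
  pos : ι → ℕ
  size : B → ℕ
  mem_init : ∀ {j}, j ∈ init ↔ label j = none
  mem_block : ∀ {b j}, j ∈ block b ↔ label j = some b
  pos_inj : ∀ {i j}, label i = label j → pos i = pos j → i = j
  size_pos : ∀ b, 0 < size b
  lt_size_iff : ∀ {b x}, x < size b ↔ ∃ j, label j = some b ∧ pos j = x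

namespace BlockSystem

variable {V : Type*} [AddCommGroup V] [Module ℂ V] {ι B : Type*} [Fintype ι] [DecidableEq ι]
  [Fintype B] [DecidableEq B] (S : BlockSystem ι B) (e : Module.Basis ι ℂ V) (m p : ℕ)

omit [Fintype ι] [DecidableEq ι] [Fintype B] [DecidableEq B] in
theorem card_block (b : B) : (S.block b).card = S.size b := by
  rw [← Finset.card_range (S.size b)]
  refine Finset.card_bij (fun j _ => S.pos j) (fun j hj => ?_) (fun i hi j hj h => ?_)
    fun x hx => ?_
  · exact Finset.mem_range.2 (S.lt_size_iff.2 ⟨j, S.mem_block.1 hj, rfl⟩)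
  · exact S.pos_inj ((S.mem_block.1 hi).trans (S.mem_block.1 hj).symm) h
  · obtain ⟨j, hj, hx⟩ := S.lt_size_iff.1 (Finset.mem_range.1 hx)
    exact ⟨j, S.mem_block.2 hj, hx⟩

omit [Fintype ι] [DecidableEq ι] [Fintype B] [DecidableEq B] in
theorem exists_label (b : B) : ∃ j, S.label j = some b := by
  obtain ⟨j, hj, -⟩ := S.lt_size_iff.1 (S.size_pos b)
  exact ⟨j, hj⟩

/-- The product of `G(m,p,n₀)`, acting on the initial part, and of the symmetric groups on the
blocks. -/
def parabolic : Subgroup (V ≃ₗ[ℂ] V) :=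
  blockFactor e m p (S.init : Set ι) ⊔ ⨆ b, blockFactor e 1 1 (S.block b : Set ι)

variable {m p}

omit [Fintype B] [DecidableEq B] in
theorem mem_parabolic {g : V ≃ₗ[ℂ] V} : g ∈ S.parabolic e m p ↔
    ∃ (σ : Equiv.Perm ι) (θ : ι → rootsOfUnity m ℂ), (∏ i, θ i) ^ (m / p) = 1 ∧
      (∀ i, S.label (σ i) = S.label i) ∧ (∀ i, S.label i ≠ none → θ i = 1) ∧
      g = monomialMap e σ θ := by
  constructor
  · intro hg
    let Q : Subgroup (V ≃ₗ[ℂ] V) :=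
      { carrier := {g | ∃ (σ : Equiv.Perm ι) (θ : ι → rootsOfUnity m ℂ),
          (∏ i, θ i) ^ (m / p) = 1 ∧ (∀ i, S.label (σ i) = S.label i) ∧
          (∀ i, S.label i ≠ none → θ i = 1) ∧ g = monomialMap e σ θ}
        one_mem' := ⟨1, 1, by simp, by simp, by simp, (monomialMap_one e).symm⟩
        mul_mem' := by
          rintro _ _ ⟨σ, θ, h1, h2, h3, rfl⟩ ⟨τ, η, h1', h2', h3', rfl⟩
          refine ⟨_, _, ?_, fun i => ?_, fun i hi => ?_, monomialMap_mul e σ τ θ η⟩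
          · rw [Finset.prod_mul_distrib, Equiv.prod_comp τ θ, mul_pow, h1, h1', one_mul]
          · rw [Equiv.Perm.mul_apply, h2, h2']
          · rw [h3' i hi, h3 _ (by rwa [h2']), one_mul]
        inv_mem' := by
          rintro _ ⟨σ, θ, h1, h2, h3, rfl⟩
          have h2' : ∀ i, S.label (σ⁻¹ i) = S.label i := fun i => by
            rw [← h2 (σ⁻¹ i), Equiv.Perm.coe_inv, Equiv.apply_symm_apply]
          refine ⟨_, _, ?_, h2', fun i hi => ?_, monomialMap_inv e σ θ⟩
          · rw [Equiv.prod_comp σ⁻¹ (fun i => (θ i)⁻¹), Finset.prod_inv_distrib, inv_pow, h1,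
              inv_one]
          · rw [h3 _ (by rwa [h2']), inv_one] }
    suffices h : S.parabolic e m p ≤ Q from h hg
    refine sup_le ?_ (iSup_le fun b => ?_)
    · intro x hx
      obtain ⟨σ, θ, h1, h2, rfl⟩ := mem_blockFactor.1 hx
      simp only [Finset.mem_coe, S.mem_init] at h2
      refine ⟨σ, θ, h1, fun i => ?_, fun i hi => (h2 i hi).2, rfl⟩
      by_cases hi : S.label i = none
      · by_contra hc
        rw [hi] at hc
        exact hc (by rw [σ.injective (h2 _ hc).1, hi])
      · rw [(h2 i hi).1]
    · intro x hx
      obtain ⟨σ, θ, h1, h2, rfl⟩ := mem_blockFactor.1 hx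
      simp only [Finset.mem_coe, S.mem_block] at h2
      refine ⟨σ, 1, by simp, fun i => ?_, fun i hi => rfl, eq_monomialMap e fun i => ?_⟩
      · by_cases hi : S.label i = some b
        · by_contra hc
          rw [hi] at hc
          exact hc (by rw [σ.injective (h2 _ hc).1, hi])
        · rw [(h2 i hi).1]
      · rw [monomialMap_apply]
        congr 2
        simpa using rootsOfUnity_pow_self (θ i)
  · rintro ⟨σ, θ, h1, h2, h3, rfl⟩
    have hdiag : monomialMap e 1 θ ∈ S.parabolic e m p :=
      Subgroup.mem_sup_left (mem_blockFactor.2 ⟨1, θ, h1, fun i hi =>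
        ⟨rfl, h3 i (by simpa [S.mem_init] using hi)⟩, rfl⟩)
    have hperm : monomialMap e σ (1 : ι → rootsOfUnity m ℂ) ∈ S.parabolic e m p := by
      refine perm_induction_of_fiber S.label
        (C := fun σ => monomialMap e σ (1 : ι → rootsOfUnity m ℂ) ∈ S.parabolic e m p)
        ?_ (fun i j τ hij hl h => ?_) σ h2
      · rw [monomialMap_one]
        exact Subgroup.one_mem _
      · have hswap : monomialMap e (Equiv.swap i j) (1 : ι → rootsOfUnity m ℂ) ∈
            S.parabolic e m p := by
          cases hi : S.label i with
          | none =>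
            refine Subgroup.mem_sup_left (mem_blockFactor.2 ⟨_, 1, by simp, fun x hx => ?_, rfl⟩)
            simp only [Finset.mem_coe, S.mem_init] at hx
            refine ⟨Equiv.swap_apply_of_ne_of_ne ?_ ?_, rfl⟩
            · rintro rfl; exact hx hi
            · rintro rfl; exact hx (hl ▸ hi)
          | some b =>
            refine Subgroup.mem_sup_right (Subgroup.mem_iSup_of_mem b (mem_blockFactor.2
              ⟨Equiv.swap i j, 1, by simp, fun x hx => ?_, ?_⟩))
            · simp only [Finset.mem_coe, S.mem_block] at hx
              refine ⟨Equiv.swap_apply_of_ne_of_ne ?_ ?_, rfl⟩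
              · rintro rfl; exact hx hi
              · rintro rfl; exact hx (hl ▸ hi)
            · exact eq_monomialMap e fun i => by simp
        have := Subgroup.mul_mem _ hswap h
        rw [monomialMap_mul] at this
        convert this using 2
        funext i
        simp
    have := Subgroup.mul_mem _ hperm hdiag
    rw [monomialMap_mul] at this
    simpa using this

/-! ### The fixed space of the parabolic subgroup -/

/-- Each basis vector of the initial part is moved by a diagonal element of the first factor of
the parabolic subgroup. This fails exactly when that factor is trivial on a nonzero space. -/
def IsNondegenerate (m p : ℕ) : Prop :=
  ∀ j, S.label j = none → ∃ θ : ι → rootsOfUnity m ℂ,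
    (∀ i, S.label i ≠ none → θ i = 1) ∧ (∏ i, θ i) ^ (m / p) = 1 ∧ θ j ≠ 1

variable {S}

omit [Fintype B] [DecidableEq B] in
theorem mem_fixedSpace_parabolic (hS : S.IsNondegenerate m p) {v : V} :
    v ∈ fixedSpace (S.parabolic e m p) ↔ (∀ j, S.label j = none → e.repr v j = 0) ∧
      ∀ i j, S.label i = S.label j → e.repr v i = e.repr v j := by
  constructor
  · intro hv
    constructor
    · intro j hj
      obtain ⟨θ, h1, h2, h3⟩ := hS j hj
      have hfix : monomialMap e 1 θ v = v :=
        hv _ ((S.mem_parabolic e).2 ⟨1, θ, h2, fun _ => rfl, h1, rfl⟩)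
      have := monomialMap_repr e 1 θ v j
      rw [hfix, Equiv.Perm.one_apply] at this
      by_contra hc
      exact h3 (Subtype.ext (Units.ext (mul_right_cancel₀ hc (by simpa using this.symm))))
    · intro i j hij
      have hfix : monomialMap e (Equiv.swap i j) (1 : ι → rootsOfUnity m ℂ) v = v := by
        refine hv _ ((S.mem_parabolic e).2 ⟨_, 1, by simp, fun x => ?_, fun _ _ => rfl, rfl⟩)
        rw [Equiv.swap_apply_def]
        split_ifs with h h' <;> simp [*]
      have := monomialMap_repr e (Equiv.swap i j) (1 : ι → rootsOfUnity m ℂ) v i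
      rw [hfix] at this
      simpa using this.symm
  · rintro ⟨h0, hc⟩ g hg
    obtain ⟨σ, θ, -, h2, h3, rfl⟩ := (S.mem_parabolic e).1 hg
    refine e.ext_elem fun i => ?_
    obtain ⟨j, rfl⟩ := σ.surjective i
    rw [monomialMap_repr]
    by_cases hj : S.label j = none
    · rw [h0 j hj, h0 _ (by rw [h2, hj]), mul_zero]
    · rw [h3 j hj, hc _ _ (h2 j)]
      simp

variable (S)

/-- The sum of the basis vectors in a block. -/
noncomputable def blockSum (b : B) : V := ∑ j ∈ S.block b, e j

omit [Fintype B] [Fintype ι] in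
theorem blockSum_repr (b : B) (j : ι) :
    e.repr (S.blockSum e b) j = if S.label j = some b then 1 else 0 := by
  simp only [blockSum, map_sum, Module.Basis.repr_self, Finsupp.finsetSum_apply,
    Finsupp.single_apply, Finset.sum_ite_eq', S.mem_block]

omit [DecidableEq B] [Fintype ι] in
theorem sum_blockSum_repr (a : B → ℂ) (j : ι) :
    e.repr (∑ b, a b • S.blockSum e b) j = (S.label j).elim 0 a := by
  classical
  simp only [map_sum, map_smul, Finsupp.finsetSum_apply, Finsupp.smul_apply, blockSum_repr]
  cases h : S.label j with
  | none => simp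
  | some c => simp

omit [DecidableEq B] [Fintype ι] in
theorem linearIndependent_blockSum : LinearIndependent ℂ (S.blockSum e) := by
  rw [Fintype.linearIndependent_iff]
  intro a ha b
  obtain ⟨j, hj⟩ := S.exists_label b
  have := S.sum_blockSum_repr e a j
  rw [ha, hj] at this
  simpa using this.symm

variable {S}

omit [Fintype B] in
theorem blockSum_mem (hS : S.IsNondegenerate m p) (b : B) :
    S.blockSum e b ∈ fixedSpace (S.parabolic e m p) := by
  rw [mem_fixedSpace_parabolic e hS]
  refine ⟨fun j hj => ?_, fun i j hij => ?_⟩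
  · rw [blockSum_repr, hj, if_neg (by simp)]
  · rw [blockSum_repr, blockSum_repr, hij]

omit [DecidableEq B] in
theorem exists_eq_sum_blockSum (hS : S.IsNondegenerate m p) {v : V}
    (hv : v ∈ fixedSpace (S.parabolic e m p)) :
    ∃ a : B → ℂ, v = ∑ b, a b • S.blockSum e b ∧
      ∀ j b, S.label j = some b → a b = e.repr v j := by
  obtain ⟨h0, hc⟩ := (mem_fixedSpace_parabolic e hS).1 hv
  choose r hr using S.exists_label
  have key : ∀ j b, S.label j = some b → e.repr v (r b) = e.repr v j :=
    fun j b h => hc _ _ ((hr b).trans h.symm)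
  refine ⟨fun b => e.repr v (r b), e.ext_elem fun j => ?_, key⟩
  rw [sum_blockSum_repr]
  cases h : S.label j with
  | none => exact h0 j h
  | some b => exact (key j b h).symm

omit [DecidableEq B] in
theorem span_blockSum (hS : S.IsNondegenerate m p) :
    Submodule.span ℂ (Set.range (S.blockSum e)) = fixedSpace (S.parabolic e m p) := by
  classical
  apply le_antisymm
  · rw [Submodule.span_le]
    rintro _ ⟨b, rfl⟩
    exact blockSum_mem e hS b
  · intro v hv
    obtain ⟨a, rfl, -⟩ := exists_eq_sum_blockSum e hS hv
    exact Submodule.sum_mem _ fun b _ => Submodule.smul_mem _ _ (Submodule.subset_span ⟨b, rfl⟩)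

/-- The block sums, as a basis of the fixed space of the parabolic subgroup. -/
noncomputable def fixedBasis (hS : S.IsNondegenerate m p) :
    Module.Basis B ℂ (fixedSpace (S.parabolic e m p)) :=
  (Module.Basis.span (S.linearIndependent_blockSum e)).map
    (LinearEquiv.ofEq _ _ (span_blockSum e hS))

omit [DecidableEq B] in
@[simp]
theorem coe_fixedBasis (hS : S.IsNondegenerate m p) (b : B) :
    (fixedBasis e hS b : V) = S.blockSum e b := by
  simp [fixedBasis, Module.Basis.span_apply]

variable (S m p)

/-- The fixed vectors of the parabolic subgroup in the span of the blocks of size `k`. -/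
def isotypic (k : ℕ) : Submodule ℂ V :=
  Submodule.span ℂ {v | ∃ b, S.size b = k ∧ ∃ j ∈ S.block b, v = e j} ⊓
    fixedSpace (S.parabolic e m p)

variable {S m p}

omit [DecidableEq B] in
theorem span_blockSum_isotypic (hS : S.IsNondegenerate m p) (k : ℕ) :
    Submodule.span ℂ (Set.range fun b : {b // S.size b = k} => S.blockSum e b) =
      S.isotypic e m p k := by
  classical
  apply le_antisymm
  · rw [Submodule.span_le]
    rintro _ ⟨⟨b, hb⟩, rfl⟩
    exact ⟨Submodule.sum_mem _ fun j hj => Submodule.subset_span ⟨b, hb, j, hj, rfl⟩,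
      blockSum_mem e hS b⟩
  · rintro v ⟨hv1, hv⟩
    obtain ⟨a, hva, ha⟩ := exists_eq_sum_blockSum e hS hv
    have hset : {v | ∃ b, S.size b = k ∧ ∃ j ∈ S.block b, v = e j} =
        e '' {j | ∃ b, S.size b = k ∧ j ∈ S.block b} := by
      ext v
      constructor
      · rintro ⟨b, hb, j, hj, rfl⟩
        exact ⟨j, ⟨b, hb, hj⟩, rfl⟩
      · rintro ⟨j, ⟨b, hb, hj⟩, rfl⟩
        exact ⟨b, hb, j, hj, rfl⟩
    rw [SetLike.mem_coe, hset, e.mem_span_image] at hv1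
    rw [hva]
    refine Submodule.sum_mem _ fun b _ => ?_
    by_cases hb : S.size b = k
    · exact Submodule.smul_mem _ _ (Submodule.subset_span ⟨⟨b, hb⟩, rfl⟩)
    · obtain ⟨j, hj⟩ := S.exists_label b
      have : a b = 0 := by
        rw [ha j b hj]
        by_contra hc
        obtain ⟨b', hb', hj'⟩ := hv1 (Finset.mem_coe.2 (Finsupp.mem_support_iff.2 hc))
        rw [S.mem_block, hj] at hj'
        exact hb (Option.some.inj hj' ▸ hb')
      simp [this]

/-- The sums of the blocks of size `k`, as a basis of `isotypic k`. -/
noncomputable def isotypicBasis (hS : S.IsNondegenerate m p) (k : ℕ) :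
    Module.Basis {b // S.size b = k} ℂ (S.isotypic e m p k) :=
  (Module.Basis.span ((S.linearIndependent_blockSum e).comp _ Subtype.val_injective)).map
    (LinearEquiv.ofEq _ _ (span_blockSum_isotypic e hS k))

omit [DecidableEq B] in
@[simp]
theorem coe_isotypicBasis (hS : S.IsNondegenerate m p) (k : ℕ) (b : {b // S.size b = k}) :
    (isotypicBasis e hS k b : V) = S.blockSum e b := by
  simp [isotypicBasis, Module.Basis.span_apply]

omit [DecidableEq B] in
theorem isotypic_submoduleOf (hS : S.IsNondegenerate m p) (k : ℕ) :
    (S.isotypic e m p k).submoduleOf (fixedSpace (S.parabolic e m p)) =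
      Submodule.span ℂ (fixedBasis e hS '' {b | S.size b = k}) := by
  have hinj := (fixedSpace (S.parabolic e m p)).injective_subtype
  apply Submodule.map_injective_of_injective hinj
  rw [Submodule.submoduleOf, Submodule.map_comap_subtype, Submodule.map_span,
    inf_eq_right.2 (show S.isotypic e m p k ≤ _ from inf_le_right), ← span_blockSum_isotypic e hS]
  congr 1
  ext v
  simp

omit [DecidableEq B] in
/-- The fixed space is the direct sum of the spaces `isotypic k`, because these are spanned by
the parts of a partition of a basis. -/
theorem isInternal_isotypic (hS : S.IsNondegenerate m p) :
    DirectSum.IsInternal fun k : Set.range S.size =>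
      (S.isotypic e m p k).submoduleOf (fixedSpace (S.parabolic e m p)) := by
  refine DirectSum.isInternal_submodule_of_iSupIndep_of_iSup_eq_top ?_ ?_
  · intro k
    simp only [isotypic_submoduleOf e hS]
    refine ((fixedBasis e hS).linearIndependent.disjoint_span_image
      (s := {b | S.size b = k}) (t := {b | S.size b ≠ k}) ?_).mono_right ?_
    · exact Set.disjoint_left.2 fun b h h' => h' h
    · refine iSup₂_le fun l hl => Submodule.span_mono (Set.image_mono fun b hb => ?_)
      exact fun h => hl (Subtype.ext (hb.symm.trans h))
  · rw [eq_top_iff, ← (fixedBasis e hS).span_eq, Submodule.span_le]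
    rintro _ ⟨b, rfl⟩
    refine Submodule.mem_iSup_of_mem ⟨S.size b, b, rfl⟩ ?_
    rw [isotypic_submoduleOf e hS]
    exact Submodule.subset_span ⟨b, rfl, rfl⟩

/-! ### The normaliser -/

section Normalizer

variable {V : Type*} [AddCommGroup V] [Module ℂ V] {ι B : Type*} [Fintype ι] [DecidableEq ι]
  [Fintype B] [DecidableEq B] (S : BlockSystem ι B) (e : Module.Basis ι ℂ V) {m p : ℕ}

/-- The monomial map with data `σ, θ` permutes the blocks according to `τ`, and is a permutation
up to the scalar `η b` on the block `b`. -/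
def BlockForm (σ : Equiv.Perm ι) (θ : ι → rootsOfUnity m ℂ) (τ : Equiv.Perm B)
    (η : B → rootsOfUnity m ℂ) : Prop :=
  (∀ j, S.label (σ j) = (S.label j).map τ) ∧ ∀ j b, S.label j = some b → θ j = η b

variable {S} {σ : Equiv.Perm ι} {θ : ι → rootsOfUnity m ℂ} {τ : Equiv.Perm B}
  {η : B → rootsOfUnity m ℂ}

omit [Fintype ι] [DecidableEq ι] [Fintype B] [DecidableEq B] in
theorem BlockForm.mem_block_iff (h : S.BlockForm σ θ τ η) (b : B) (j : ι) :
    j ∈ S.block b ↔ σ j ∈ S.block (τ b) := by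
  rw [S.mem_block, S.mem_block, h.1]
  cases S.label j <;> simp

omit [Fintype ι] [DecidableEq ι] [Fintype B] [DecidableEq B] in
theorem BlockForm.size_eq (h : S.BlockForm σ θ τ η) (b : B) : S.size (τ b) = S.size b := by
  rw [← S.card_block, ← S.card_block]
  exact (Finset.card_equiv σ (h.mem_block_iff b)).symm

omit [Fintype ι] [DecidableEq ι] [Fintype B] [DecidableEq B] in
theorem BlockForm.map_blockSum (h : S.BlockForm σ θ τ η) (b : B) :
    monomialMap e σ θ (S.blockSum e b) = ((η b : ℂˣ) : ℂ) • S.blockSum e (τ b) := by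
  rw [blockSum, map_sum, blockSum, Finset.smul_sum]
  refine Finset.sum_equiv σ (h.mem_block_iff b) fun j hj => ?_
  rw [monomialMap_apply, h.2 j b (S.mem_block.1 hj)]

omit [Fintype ι] [DecidableEq ι] [Fintype B] [DecidableEq B] in
theorem BlockForm.inv (h : S.BlockForm σ θ τ η) :
    S.BlockForm σ⁻¹ (fun i => (θ (σ⁻¹ i))⁻¹) τ⁻¹ (fun b => (η (τ⁻¹ b))⁻¹) := by
  have h1 : ∀ j, S.label (σ⁻¹ j) = (S.label j).map ⇑τ⁻¹ := fun j => by
    have h2 := h.1 (σ⁻¹ j)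
    rw [Equiv.Perm.coe_inv, Equiv.apply_symm_apply] at h2
    rw [h2, Option.map_map]
    cases S.label (σ⁻¹ j) <;> simp_all
  refine ⟨h1, fun j b hj => ?_⟩
  exact congrArg _ (h.2 (σ⁻¹ j) (τ⁻¹ b) (by rw [h1, hj]; rfl))

omit [DecidableEq ι] in
theorem BlockForm.prod_eq (h : S.BlockForm σ θ τ η) :
    ∏ j, θ j = (∏ j ∈ S.init, θ j) * ∏ b, η b ^ S.size b := by
  rw [← Finset.prod_fiberwise Finset.univ S.label θ, Fintype.prod_option]
  congr 1
  · refine Finset.prod_congr ?_ fun _ _ => rfl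
    ext j
    simp [S.mem_init]
  · refine Finset.prod_congr rfl fun b _ => ?_
    rw [← S.card_block]
    have hb : Finset.univ.filter (fun j => S.label j = some b) = S.block b := by
      ext j
      simp [S.mem_block]
    rw [hb]
    exact Finset.prod_eq_pow_card fun j hj => h.2 j b (S.mem_block.1 hj)

omit [Fintype B] [DecidableEq B] in
theorem BlockForm.conj_mem (h : S.BlockForm σ θ τ η) {x : V ≃ₗ[ℂ] V}
    (hx : x ∈ S.parabolic e m p) :
    monomialMap e σ θ * x * (monomialMap e σ θ)⁻¹ ∈ S.parabolic e m p := by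
  obtain ⟨α, ξ, h1, h2, h3, rfl⟩ := (S.mem_parabolic e).1 hx
  rw [S.mem_parabolic e, monomialMap_inv, monomialMap_mul, monomialMap_mul]
  refine ⟨_, _, ?_, fun i => ?_, fun i hi => ?_, rfl⟩
  · rw [Equiv.prod_comp σ⁻¹ (fun i => θ (α i) * ξ i * (θ i)⁻¹), Finset.prod_mul_distrib,
      Finset.prod_mul_distrib, Equiv.prod_comp α, Finset.prod_inv_distrib, mul_right_comm,
      mul_inv_cancel, one_mul, h1]
  · rw [Equiv.Perm.mul_apply, Equiv.Perm.mul_apply, h.1, h2, ← h.1, Equiv.Perm.coe_inv,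
      Equiv.apply_symm_apply]
  · have hi' : S.label (σ⁻¹ i) ≠ none := by
      rw [h.inv.1]
      cases hc : S.label i <;> simp_all
    obtain ⟨b, hb⟩ := Option.ne_none_iff_exists'.1 hi'
    rw [h3 _ hi', h.2 _ b hb, h.2 _ b (by rw [h2, hb]), mul_one, mul_inv_cancel]

theorem map_mem_fixedSpace {G P : Subgroup (V ≃ₗ[ℂ] V)} {g : V ≃ₗ[ℂ] V}
    (hg : g ∈ normalizerIn G P) {v : V} (hv : v ∈ fixedSpace P) : g v ∈ fixedSpace P := by
  intro x hx
  have h1 : g⁻¹ * x * g ∈ P := by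
    have := (Subgroup.mem_normalizer_iff.1 (inv_mem hg.2) x).1 hx
    rwa [inv_inv] at this
  have h2 : (g * (g⁻¹ * x * g)) v = g v := congrArg g (hv _ h1)
  rwa [show g * (g⁻¹ * x * g) = x * g by group] at h2

omit [Fintype B] in
/-- A monomial map that preserves the fixed space of the parabolic subgroup pulls indices of a
common block back to indices of a common block, on which its coefficients agree: look at the
coordinates of the image of a block sum. -/
theorem label_eq_of_mem_normalizer (hS : S.IsNondegenerate m p) {G : Subgroup (V ≃ₗ[ℂ] V)}
    (hg : monomialMap e σ θ ∈ normalizerIn G (S.parabolic e m p)) {j : ι}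
    (hj : S.label j ≠ none) :
    S.label (σ j) ≠ none ∧
      ∀ j', S.label (σ j) = S.label (σ j') → S.label j' = S.label j ∧ θ j' = θ j := by
  obtain ⟨b, hb⟩ := Option.ne_none_iff_exists'.1 hj
  have hmem := map_mem_fixedSpace hg (blockSum_mem e hS b)
  obtain ⟨h0, hc⟩ := (mem_fixedSpace_parabolic e hS).1 hmem
  have hr : ∀ i, e.repr (monomialMap e σ θ (S.blockSum e b)) (σ i) =
      if S.label i = some b then ((θ i : ℂˣ) : ℂ) else 0 := fun i => by
    rw [monomialMap_repr, blockSum_repr]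
    split_ifs <;> simp
  refine ⟨fun h => ?_, fun j' h => ?_⟩
  · have := h0 _ h
    rw [hr, if_pos hb] at this
    exact Units.ne_zero _ this
  · have := hc _ _ h
    rw [hr, hr, if_pos hb] at this
    split_ifs at this with h'
    · exact ⟨h'.trans hb.symm, Subtype.ext (Units.ext this.symm)⟩
    · exact absurd this (Units.ne_zero _)

/-- The normaliser of the parabolic subgroup in `G(m,p,n)` consists of the elements that permute
the blocks and have constant coefficients on each block. -/
theorem mem_normalizerIn (hS : S.IsNondegenerate m p) {g : V ≃ₗ[ℂ] V} :
    g ∈ normalizerIn (monomialGroup e m p) (S.parabolic e m p) ↔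
      ∃ (σ : Equiv.Perm ι) (θ : ι → rootsOfUnity m ℂ) (τ : Equiv.Perm B)
        (η : B → rootsOfUnity m ℂ), (∏ i, θ i) ^ (m / p) = 1 ∧ S.BlockForm σ θ τ η ∧
          g = monomialMap e σ θ := by
  constructor
  · intro hg
    obtain ⟨σ, θ, hθ, rfl⟩ := (mem_monomialGroup e).1 hg.1
    have h1 := fun j => label_eq_of_mem_normalizer e hS hg (j := j)
    have hg' := inv_mem hg
    rw [monomialMap_inv] at hg'
    have h2 := fun j => label_eq_of_mem_normalizer e hS hg' (j := j)
    have h3 : ∀ i i', S.label i ≠ none → S.label i = S.label i' →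
        S.label (σ i) = S.label (σ i') := fun i i' hi hii => by
      have := ((h2 (σ i) (h1 i hi).1).2 (σ i') (by simpa using hii)).1
      exact this.symm
    have h4 : ∀ i, S.label i = none → S.label (σ i) = none := fun i hi => by
      by_contra hc
      have := (h2 (σ i) hc).1
      simp [hi] at this
    choose r hr using S.exists_label
    have hr' : ∀ b, S.label (r b) ≠ none := fun b => by simp [hr]
    choose t ht using fun b => Option.ne_none_iff_exists'.1 (h1 (r b) (hr' b)).1
    have htinj : Function.Injective t := fun b b' hbb => by
      have := ((h1 (r b) (hr' b)).2 (r b') (by rw [ht, ht, hbb])).1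
      rw [hr, hr] at this
      exact (Option.some.inj this).symm
    refine ⟨σ, θ, Equiv.ofBijective t (Finite.injective_iff_bijective.1 htinj),
      fun b => θ (r b), hθ, ⟨fun j => ?_, fun j b hj => ?_⟩, rfl⟩
    · cases hj : S.label j with
      | none => exact h4 j hj
      | some b => exact (h3 (r b) j (hr' b) (by rw [hr, hj])).symm.trans (ht b)
    · have hl : S.label (r b) = S.label j := by rw [hr, hj]
      exact ((h1 (r b) (hr' b)).2 j (h3 _ _ (hr' b) hl)).2
  · rintro ⟨σ, θ, τ, η, hθ, h, rfl⟩
    refine ⟨(mem_monomialGroup e).2 ⟨σ, θ, hθ, rfl⟩, Subgroup.mem_normalizer_iff.2 fun x => ?_⟩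
    refine ⟨fun hx => h.conj_mem e hx, fun hx => ?_⟩
    have := h.inv.conj_mem e hx
    rw [← monomialMap_inv] at this
    simpa [mul_assoc] using this

omit [DecidableEq B] in
theorem parabolic_le (hS : S.IsNondegenerate m p) :
    S.parabolic e m p ≤ normalizerIn (monomialGroup e m p) (S.parabolic e m p) := by
  classical
  intro g hg
  obtain ⟨σ, θ, h1, h2, h3, rfl⟩ := (S.mem_parabolic e).1 hg
  refine (mem_normalizerIn e hS).2 ⟨σ, θ, 1, 1, h1, ⟨fun j => ?_, fun j b hj => ?_⟩, rfl⟩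
  · rw [h2]
    cases S.label j <;> rfl
  · exact h3 j (by simp [hj])

/-! ### A complement of the parabolic subgroup -/

/-- Any size-preserving permutation of the blocks, with arbitrary coefficients, is realised by a
monomial map which respects the enumeration of the blocks and is trivial on the initial part
except at `a`. If `a` lies in the initial part, its coefficient there makes the product
of all coefficients trivial. -/
theorem exists_blockForm {a : ι} (ha : ∀ j, S.label j = none → S.label a = none)
    (τ : Equiv.Perm B) (η : B → rootsOfUnity m ℂ) (hτ : ∀ b, S.size (τ b) = S.size b) :
    ∃ (σ : Equiv.Perm ι) (θ : ι → rootsOfUnity m ℂ), S.BlockForm σ θ τ η ∧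
      (∀ j, S.pos (σ j) = S.pos j) ∧
      (∀ j, S.label j = none → σ j = j ∧ (j ≠ a → θ j = 1)) ∧
      (S.label a = none → ∏ j, θ j = 1) ∧
      (S.label a ≠ none → ∏ j, θ j = ∏ b, η b ^ S.size b) := by
  have hex : ∀ j, ∃ j', S.label j' = (S.label j).map τ ∧ S.pos j' = S.pos j := fun j => by
    cases hj : S.label j with
    | none => exact ⟨j, hj, rfl⟩
    | some b =>
      have : S.pos j < S.size (τ b) := by
        rw [hτ]
        exact S.lt_size_iff.2 ⟨j, hj, rfl⟩
      exact S.lt_size_iff.1 this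
  choose f hf1 hf2 using hex
  have hinj : Function.Injective f := fun i j hij => by
    refine S.pos_inj (Option.map_injective τ.injective ?_) ?_
    · rw [← hf1, ← hf1, hij]
    · rw [← hf2, hij, hf2]
  let θ : ι → rootsOfUnity m ℂ := fun j =>
    (S.label j).elim (if j = a then (∏ b, η b ^ S.size b)⁻¹ else 1) η
  have hBF : S.BlockForm (Equiv.ofBijective f (Finite.injective_iff_bijective.1 hinj)) θ τ η :=
    ⟨hf1, fun j b hj => by simp [θ, hj]⟩
  refine ⟨_, θ, hBF, hf2, fun j hj => ⟨?_, fun hja => ?_⟩, fun h => ?_, fun h => ?_⟩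
  · refine S.pos_inj ?_ (hf2 j)
    rw [Equiv.ofBijective_apply, hf1, hj]
    rfl
  · simp [θ, hj, hja]
  · rw [hBF.prod_eq, Finset.prod_eq_single_of_mem a (S.mem_init.2 h) fun j hj hja => ?_]
    · simp [θ, h]
    · simp [θ, S.mem_init.1 hj, hja]
  · rw [hBF.prod_eq]
    have : S.init = ∅ := Finset.eq_empty_of_forall_notMem fun j hj =>
      h (ha j (S.mem_init.1 hj))
    rw [this, Finset.prod_empty, one_mul]

variable (S) in
omit [DecidableEq ι] [Fintype B] [DecidableEq B] in
/-- The monomial maps that respect the enumeration of the blocks and are trivial on the initial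
part except for a coefficient at `a`, which makes the product of all coefficients trivial if `a`
lies in the initial part. -/
def orderedGroup (a : ι) (m : ℕ) : Subgroup (V ≃ₗ[ℂ] V) where
  carrier := {g | ∃ (σ : Equiv.Perm ι) (θ : ι → rootsOfUnity m ℂ),
    (∀ j, S.pos (σ j) = S.pos j) ∧ (∀ j, S.label j = none → σ j = j ∧ (j ≠ a → θ j = 1)) ∧
    (S.label a = none → ∏ j, θ j = 1) ∧ g = monomialMap e σ θ}
  one_mem' := ⟨1, 1, by simp, by simp, by simp, (monomialMap_one e).symm⟩
  mul_mem' := by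
    rintro _ _ ⟨σ, θ, h1, h2, h3, rfl⟩ ⟨τ, η, h1', h2', h3', rfl⟩
    refine ⟨_, _, fun j => ?_, fun j hj => ⟨?_, fun hja => ?_⟩, fun h => ?_,
      monomialMap_mul e σ τ θ η⟩
    · rw [Equiv.Perm.mul_apply, h1, h1']
    · rw [Equiv.Perm.mul_apply, (h2' j hj).1, (h2 j hj).1]
    · rw [(h2' j hj).1, (h2 j hj).2 hja, (h2' j hj).2 hja, one_mul]
    · rw [Finset.prod_mul_distrib, Equiv.prod_comp τ θ, h3 h, h3' h, one_mul]
  inv_mem' := by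
    rintro _ ⟨σ, θ, h1, h2, h3, rfl⟩
    have h2' : ∀ j, S.label j = none → σ⁻¹ j = j := fun j hj =>
      Equiv.Perm.inv_eq_iff_eq.2 (h2 j hj).1.symm
    refine ⟨_, _, fun j => ?_, fun j hj => ⟨h2' j hj, fun hja => ?_⟩, fun h => ?_,
      monomialMap_inv e σ θ⟩
    · rw [← h1 (σ⁻¹ j), Equiv.Perm.coe_inv, Equiv.apply_symm_apply]
    · rw [h2' j hj, (h2 j hj).2 hja, inv_one]
    · rw [Equiv.prod_comp σ⁻¹ (fun i => (θ i)⁻¹), Finset.prod_inv_distrib, h3 h, inv_one]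

omit [DecidableEq B] in
theorem exists_isComplement' [Nonempty ι] (hS : S.IsNondegenerate m p) :
    ∃ H : Subgroup (normalizerIn (monomialGroup e m p) (S.parabolic e m p)),
      Subgroup.IsComplement' ((S.parabolic e m p).subgroupOf _) H := by
  classical
  obtain ⟨a, ha⟩ : ∃ a, ∀ j, S.label j = none → S.label a = none := by
    by_cases h : ∃ a, S.label a = none
    · exact ⟨h.choose, fun _ _ => h.choose_spec⟩
    · exact ⟨Classical.arbitrary ι, fun j hj => absurd ⟨j, hj⟩ h⟩
  refine ⟨(S.orderedGroup e a m).subgroupOf _,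
    Subgroup.isComplement'_of_disjoint_and_mul_eq_univ ?_ ?_⟩
  · rw [Subgroup.disjoint_def]
    rintro ⟨g, hg⟩ hgP hgH
    obtain ⟨σ, θ, h1, h2, h3, rfl⟩ := (S.mem_parabolic e).1 (Subgroup.mem_subgroupOf.1 hgP)
    obtain ⟨σ', θ', h4, h5, h6, heq⟩ := Subgroup.mem_subgroupOf.1 hgH
    obtain ⟨rfl, rfl⟩ := (monomialMap_inj e).1 heq
    have hσ : σ = 1 := Equiv.ext fun j => S.pos_inj (h2 j) (h4 j)
    have hθ' : ∀ j, j ≠ a → θ j = 1 := fun j hj => by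
      by_cases hl : S.label j = none
      · exact (h5 j hl).2 hj
      · exact h3 j hl
    have hθ : θ = 1 := funext fun j => by
      by_cases hj : j = a
      · subst hj
        by_cases hl : S.label j = none
        · have := h6 hl
          rwa [Finset.prod_eq_single_of_mem j (Finset.mem_univ _) fun i _ => hθ' i] at this
        · exact h3 j hl
      · exact hθ' j hj
    apply Subtype.ext
    simp only [hσ, hθ, monomialMap_one, Subgroup.coe_one]
  · rw [Set.eq_univ_iff_forall]
    rintro ⟨g, hg⟩
    obtain ⟨σ, θ, τ, η, hθ, hBF, rfl⟩ := (mem_normalizerIn e hS).1 hg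
    obtain ⟨σ', θ', hBF', h1, h2, h3, h4⟩ := exists_blockForm ha τ η hBF.size_eq
    have hθ' : (∏ j, θ' j) ^ (m / p) = 1 := by
      by_cases h : S.label a = none
      · rw [h3 h, one_pow]
      · have : S.init = ∅ := Finset.eq_empty_of_forall_notMem fun j hj =>
          h (ha j (S.mem_init.1 hj))
        have h5 := hBF.prod_eq
        rw [this, Finset.prod_empty, one_mul] at h5
        rw [h4 h, ← h5, hθ]
    have hN := (mem_normalizerIn e hS).2 ⟨σ', θ', τ, η, hθ', hBF', rfl⟩
    have hquot : monomialMap e σ θ * (monomialMap e σ' θ')⁻¹ ∈ S.parabolic e m p := by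
      rw [S.mem_parabolic e, monomialMap_inv, monomialMap_mul]
      refine ⟨_, _, ?_, fun i => ?_, fun i hi => ?_, rfl⟩
      · rw [Equiv.prod_comp σ'⁻¹ (fun i => θ i * (θ' i)⁻¹), Finset.prod_mul_distrib,
          Finset.prod_inv_distrib, mul_pow, inv_pow, hθ, hθ', inv_one, one_mul]
      · rw [Equiv.Perm.mul_apply, hBF.1, ← hBF'.1, Equiv.Perm.coe_inv, Equiv.apply_symm_apply]
      · have hi' : S.label (σ'⁻¹ i) ≠ none := by
          rw [hBF'.inv.1]
          cases hc : S.label i <;> simp_all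
        obtain ⟨b, hb⟩ := Option.ne_none_iff_exists'.1 hi'
        rw [hBF.2 _ b hb, hBF'.2 _ b hb, mul_inv_cancel]
    refine Set.mem_mul.2 ⟨⟨_, parabolic_le e hS hquot⟩, hquot, ⟨_, hN⟩,
      ⟨σ', θ', h1, h2, h3, rfl⟩, Subtype.ext ?_⟩
    exact inv_mul_cancel_right _ _

end Normalizer

end BlockSystem

/-! ### Group-theoretic preliminaries -/

section Preliminaries

/-- A complement of the kernel of a homomorphism is mapped isomorphically onto its image. -/
theorem complement_ker {N M : Type*} [Group N] [Group M] (ρ : N →* M) {K H : Subgroup N}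
    (hK : K = ρ.ker) (h : Subgroup.IsComplement' K H) :
    Set.InjOn ρ H ∧ ∀ g, ∃ x ∈ H, ρ x = ρ g := by
  subst hK
  constructor
  · intro x hx y hy hxy
    have h1 : x * y⁻¹ ∈ ρ.ker := by
      rw [MonoidHom.mem_ker, map_mul, map_inv, hxy, mul_inv_cancel]
    exact mul_inv_eq_one.1 (Subgroup.disjoint_def.1 h.disjoint h1 (H.mul_mem hx (H.inv_mem hy)))
  · intro g
    obtain ⟨⟨k, x⟩, hkx⟩ := h.2 g
    refine ⟨x, x.2, ?_⟩
    rw [← hkx, map_mul, (MonoidHom.mem_ker).1 k.2, one_mul]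

theorem map_eval_pi {κ : Type*} [DecidableEq κ] {M : κ → Type*} [∀ k, Group (M k)]
    (K : ∀ k, Subgroup (M k)) (k : κ) :
    (Subgroup.pi Set.univ K).map (Pi.evalMonoidHom M k) = K k := by
  apply le_antisymm
  · rintro _ ⟨x, hx, rfl⟩
    exact hx k (Set.mem_univ k)
  · intro y hy
    refine ⟨Pi.mulSingle k y, fun l _ => ?_, by simp⟩
    by_cases h : l = k
    · subst h
      simpa using hy
    · change Pi.mulSingle k y l ∈ K l
      rw [Pi.mulSingle_eq_of_ne h]
      exact (K l).one_mem

theorem le_setStabilizer {W : Type*} [AddCommGroup W] [Module ℂ W] {N : Subgroup (W ≃ₗ[ℂ] W)}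
    {U : Submodule ℂ W} (h : ∀ g ∈ N, ∀ v ∈ U, g v ∈ U) : N ≤ setStabilizer U := by
  intro g hg
  refine le_antisymm ?_ fun v hv => ?_
  · rintro _ ⟨v, hv, rfl⟩
    exact h g hg v hv
  · refine ⟨g⁻¹ v, h _ (N.inv_mem hg) v hv, ?_⟩
    exact g.apply_symm_apply v

end Preliminaries

namespace BlockSystem

/-! ### The action of the normaliser on the fixed space -/

section Action

variable {V : Type*} [AddCommGroup V] [Module ℂ V] {ι B : Type*} [Fintype ι] [DecidableEq ι]
  [Fintype B] [DecidableEq B] (S : BlockSystem ι B) (e : Module.Basis ι ℂ V) (m p : ℕ)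

/-- The normaliser of the parabolic subgroup in `G(m,p,n)`. -/
abbrev normalizer : Subgroup (V ≃ₗ[ℂ] V) :=
  normalizerIn (monomialGroup e m p) (S.parabolic e m p)

omit [Fintype B] [DecidableEq B] [DecidableEq ι] in
theorem normalizer_le_stabilizer :
    S.normalizer e m p ≤ setStabilizer (fixedSpace (S.parabolic e m p)) :=
  le_setStabilizer fun _ hg _ hv => map_mem_fixedSpace hg hv

/-- The action of the normaliser on the fixed space of the parabolic subgroup. -/
def fixedAction : S.normalizer e m p →*
    (fixedSpace (S.parabolic e m p) ≃ₗ[ℂ] fixedSpace (S.parabolic e m p)) :=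
  restriction (S.normalizer_le_stabilizer e m p)

variable {S m p}

theorem normalizer_le_stabilizer_isotypic (hS : S.IsNondegenerate m p) (k : ℕ) :
    S.normalizer e m p ≤ setStabilizer (S.isotypic e m p k) := by
  refine le_setStabilizer fun g hg v hv => ?_
  obtain ⟨σ, θ, τ, η, -, h, rfl⟩ := (mem_normalizerIn e hS).1 hg
  rw [← span_blockSum_isotypic e hS] at hv ⊢
  have : Submodule.map (monomialMap e σ θ : V →ₗ[ℂ] V)
      (Submodule.span ℂ (Set.range fun b : {b // S.size b = k} => S.blockSum e b)) ≤
      Submodule.span ℂ (Set.range fun b : {b // S.size b = k} => S.blockSum e b) := by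
    rw [Submodule.map_span_le]
    rintro _ ⟨b, rfl⟩
    rw [LinearEquiv.coe_coe, h.map_blockSum e]
    exact Submodule.smul_mem _ _ (Submodule.subset_span ⟨⟨τ b, (h.size_eq b).trans b.2⟩, rfl⟩)
  exact this ⟨v, hv, rfl⟩

/-- The action of the normaliser on the space spanned by the sums of the blocks of size `k`. -/
def isotypicAction (hS : S.IsNondegenerate m p) (k : ℕ) : S.normalizer e m p →*
    (S.isotypic e m p k ≃ₗ[ℂ] S.isotypic e m p k) :=
  restriction (normalizer_le_stabilizer_isotypic e hS k)

theorem exists_fixedAction_eq (hS : S.IsNondegenerate m p) (g : S.normalizer e m p) :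
    ∃ (σ : Equiv.Perm ι) (θ : ι → rootsOfUnity m ℂ) (τ : Equiv.Perm B)
      (η : B → rootsOfUnity m ℂ), (∏ i, θ i) ^ (m / p) = 1 ∧ S.BlockForm σ θ τ η ∧
      (g : V ≃ₗ[ℂ] V) = monomialMap e σ θ ∧
      S.fixedAction e m p g = monomialMap (fixedBasis e hS) τ η := by
  obtain ⟨g, hg⟩ := g
  obtain ⟨σ, θ, τ, η, hθ, h, rfl⟩ := (mem_normalizerIn e hS).1 hg
  refine ⟨σ, θ, τ, η, hθ, h, rfl, eq_monomialMap _ fun b => Subtype.ext ?_⟩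
  have h1 : ((S.fixedAction e m p ⟨_, hg⟩ (fixedBasis e hS b) :
      fixedSpace (S.parabolic e m p)) : V) = monomialMap e σ θ (fixedBasis e hS b) := rfl
  rw [h1, coe_fixedBasis, h.map_blockSum e]
  simp

/-- Elements of the normaliser with prescribed action on the fixed space. The only constraint on
the coefficients arises if there is no initial part. -/
theorem exists_fixedAction_eq_monomialMap [Nonempty ι] (hS : S.IsNondegenerate m p)
    (τ : Equiv.Perm B) (η : B → rootsOfUnity m ℂ) (hτ : ∀ b, S.size (τ b) = S.size b)
    (hη : S.init = ∅ → (∏ b, η b ^ S.size b) ^ (m / p) = 1) :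
    ∃ g : S.normalizer e m p, S.fixedAction e m p g = monomialMap (fixedBasis e hS) τ η := by
  obtain ⟨a, ha⟩ : ∃ a, ∀ j, S.label j = none → S.label a = none := by
    by_cases h : ∃ a, S.label a = none
    · exact ⟨h.choose, fun _ _ => h.choose_spec⟩
    · exact ⟨Classical.arbitrary ι, fun j hj => absurd ⟨j, hj⟩ h⟩
  obtain ⟨σ, θ, h, -, -, h3, h4⟩ := exists_blockForm ha τ η hτ
  have hθ : (∏ j, θ j) ^ (m / p) = 1 := by
    by_cases hl : S.label a = none
    · rw [h3 hl, one_pow]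
    · rw [h4 hl]
      exact hη (Finset.eq_empty_of_forall_notMem fun j hj => hl (ha j (S.mem_init.1 hj)))
  refine ⟨⟨monomialMap e σ θ, (mem_normalizerIn e hS).2 ⟨σ, θ, τ, η, hθ, h, rfl⟩⟩,
    eq_monomialMap _ fun b => Subtype.ext ?_⟩
  have h1 : ((S.fixedAction e m p ⟨_, (mem_normalizerIn e hS).2 ⟨σ, θ, τ, η, hθ, h, rfl⟩⟩
      (fixedBasis e hS b) : fixedSpace (S.parabolic e m p)) : V) =
      monomialMap e σ θ (fixedBasis e hS b) := rfl
  rw [h1, coe_fixedBasis, h.map_blockSum e]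
  simp

/-- The action on `isotypic k` is read off from the action on the fixed space. -/
theorem isotypicAction_eq (hS : S.IsNondegenerate m p) {g : S.normalizer e m p}
    {τ : Equiv.Perm B} {η : B → rootsOfUnity m ℂ}
    (hg : S.fixedAction e m p g = monomialMap (fixedBasis e hS) τ η) {k : ℕ}
    {τ' : Equiv.Perm {b // S.size b = k}} {η' : {b // S.size b = k} → rootsOfUnity m ℂ}
    (hτ : ∀ b, τ b.1 = τ' b) (hη : ∀ b, η b.1 = η' b) :
    isotypicAction e hS k g = monomialMap (isotypicBasis e hS k) τ' η' := by
  refine eq_monomialMap _ fun b => Subtype.ext ?_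
  have h1 : ((isotypicAction e hS k g (isotypicBasis e hS k b) : S.isotypic e m p k) : V) =
      g.1 (isotypicBasis e hS k b : V) := rfl
  have h2 := congrArg (Subtype.val) (LinearEquiv.congr_fun hg (fixedBasis e hS b.1))
  have h3 : ((S.fixedAction e m p g (fixedBasis e hS b.1) :
      fixedSpace (S.parabolic e m p)) : V) = g.1 (fixedBasis e hS b.1 : V) := rfl
  rw [h3, monomialMap_apply] at h2
  simp only [coe_fixedBasis, Submodule.coe_smul] at h2
  rw [h1, coe_isotypicBasis, h2, hη, hτ]
  simp

theorem exists_isotypicAction_eq (hS : S.IsNondegenerate m p) {g : S.normalizer e m p}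
    {τ : Equiv.Perm B} {η : B → rootsOfUnity m ℂ} (hτ : ∀ b, S.size (τ b) = S.size b)
    (hg : S.fixedAction e m p g = monomialMap (fixedBasis e hS) τ η) (k : ℕ) :
    ∃ τ', isotypicAction e hS k g =
      monomialMap (isotypicBasis e hS k) τ' (fun b => η b.1) :=
  ⟨τ.subtypePerm fun b => by rw [hτ], isotypicAction_eq e hS hg (fun _ => rfl) fun _ => rfl⟩

theorem subgroupOf_parabolic_eq_ker (hS : S.IsNondegenerate m p) :
    (S.parabolic e m p).subgroupOf (S.normalizer e m p) = (S.fixedAction e m p).ker := by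
  ext g
  rw [Subgroup.mem_subgroupOf, MonoidHom.mem_ker]
  constructor
  · exact fun hg => LinearEquiv.ext fun v => Subtype.ext (v.2 _ hg)
  · intro hg
    obtain ⟨σ, θ, τ, η, hθ, h, hge, hga⟩ := exists_fixedAction_eq e hS g
    rw [hg, ← monomialMap_one (m := m) (fixedBasis e hS)] at hga
    obtain ⟨rfl, rfl⟩ := (monomialMap_inj _).1 hga
    refine (S.mem_parabolic e).2 ⟨σ, θ, hθ, fun i => ?_, fun i hi => ?_, hge⟩
    · rw [h.1]
      cases S.label i <;> rfl
    · obtain ⟨b, hb⟩ := Option.ne_none_iff_exists'.1 hi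
      exact h.2 i b hb

/-! ### The reflection part of a complement -/

omit [Fintype ι] [DecidableEq ι] [DecidableEq B] in
theorem prod_fiber_eq (η : B → rootsOfUnity m ℂ) (k : ℕ) :
    ∏ b with S.size b = k, η b = ∏ b : {b // S.size b = k}, η b :=
  Finset.prod_subtype _ (by simp) _

theorem map_isotypicAction (hS : S.IsNondegenerate m p) (H : Subgroup (S.normalizer e m p))
    {K : ∀ k : Set.range S.size,
      Subgroup (S.isotypic e m p k ≃ₗ[ℂ] S.isotypic e m p k)}
    (hK : H.map (MonoidHom.pi fun k : Set.range S.size => isotypicAction e hS k) =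
      Subgroup.pi Set.univ K) (k : Set.range S.size) :
    H.map (isotypicAction e hS k) = K k := by
  rw [← map_eval_pi K k, ← hK, Subgroup.map_map]
  rfl

omit [DecidableEq ι] in
/-- Without an initial part, the coefficients of an element of the normaliser satisfy a single
equation. -/
theorem BlockForm.prod_pow_eq_one (hinit : S.init = ∅) {σ : Equiv.Perm ι}
    {θ : ι → rootsOfUnity m ℂ} {τ : Equiv.Perm B} {η : B → rootsOfUnity m ℂ}
    (h : S.BlockForm σ θ τ η) (hθ : (∏ i, θ i) ^ (m / p) = 1) :
    (∏ b, η b ^ S.size b) ^ (m / p) = 1 := by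
  have := h.prod_eq
  rw [hinit, Finset.prod_empty, one_mul] at this
  rw [← this, hθ]

variable [NeZero m] [Nonempty ι] {r : ℕ → ℕ}
  {H : Subgroup (S.normalizer e m p)}

/-- If the coefficients whose products over the blocks of size `k` lie in `μ_{m / r k}` are
realised in the normaliser, then the corresponding maps of the fixed space come from the
reflection part of any complement. -/
theorem monomialMap_mem_map_reflectionPart (hS : S.IsNondegenerate m p)
    (h₁ : ∀ η : B → rootsOfUnity m ℂ, (∀ k, (∏ b with S.size b = k, η b) ^ (m / r k) = 1) →
      S.init = ∅ → (∏ b, η b ^ S.size b) ^ (m / p) = 1)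
    (hH : Subgroup.IsComplement' ((S.parabolic e m p).subgroupOf _) H)
    {τ : Equiv.Perm B} {η : B → rootsOfUnity m ℂ} (hτ : ∀ b, S.size (τ b) = S.size b)
    (hη : ∀ k, (∏ b with S.size b = k, η b) ^ (m / r k) = 1) :
    monomialMap (fixedBasis e hS) τ η ∈
      (reflectionPart (S.fixedAction e m p) H).map (S.fixedAction e m p) := by
  refine monomialMap_mem_of_reflections_mem (fixedBasis e hS) S.size (fun k => m / r k) _
    (fun τ η hτ hη hrefl => ?_) τ η hτ hη
  obtain ⟨g, hg⟩ := exists_fixedAction_eq_monomialMap e hS τ η hτ (h₁ η hη)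
  obtain ⟨x, hx, hxg⟩ := (complement_ker _ (subgroupOf_parabolic_eq_ker e hS) hH).2 g
  rw [hg] at hxg
  exact ⟨x, Subgroup.subset_closure ⟨hx, by rwa [hxg]⟩, hxg⟩

/-- If moreover the reflections in the normaliser satisfy the same condition on the products of
coefficients, then the reflection part of any complement is the product of the groups
`G(m, r k, b_k)`. -/
theorem map_pi_reflectionPart (hS : S.IsNondegenerate m p)
    (h₁ : ∀ η : B → rootsOfUnity m ℂ, (∀ k, (∏ b with S.size b = k, η b) ^ (m / r k) = 1) →
      S.init = ∅ → (∏ b, η b ^ S.size b) ^ (m / p) = 1)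
    (h₂ : ∀ (σ : Equiv.Perm ι) (θ : ι → rootsOfUnity m ℂ) (τ : Equiv.Perm B)
      (η : B → rootsOfUnity m ℂ), (∏ i, θ i) ^ (m / p) = 1 → S.BlockForm σ θ τ η →
      IsReflection (monomialMap (fixedBasis e hS) τ η) →
      ∀ k, (∏ b with S.size b = k, η b) ^ (m / r k) = 1)
    (hH : Subgroup.IsComplement' ((S.parabolic e m p).subgroupOf _) H) :
    (reflectionPart (S.fixedAction e m p) H).map
        (MonoidHom.pi fun k : Set.range S.size => isotypicAction e hS k) =
      Subgroup.pi Set.univ fun k : Set.range S.size =>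
        monomialGroup (isotypicBasis e hS k) m (r k) := by
  apply le_antisymm
  · rw [reflectionPart, Subgroup.map_le_iff_le_comap, Subgroup.closure_le]
    rintro g ⟨-, hrefl⟩ k -
    obtain ⟨σ, θ, τ, η, hθ, h, -, hga⟩ := exists_fixedAction_eq e hS g
    rw [hga] at hrefl
    obtain ⟨τ', hτ'⟩ := exists_isotypicAction_eq e hS h.size_eq hga k
    exact (mem_monomialGroup _).2 ⟨τ', _, by
      rw [← prod_fiber_eq]
      exact h₂ σ θ τ η hθ h hrefl k, hτ'⟩
  · intro x hx
    have hx' := fun k : Set.range S.size => (mem_monomialGroup (isotypicBasis e hS k)).1 (hx k (Set.mem_univ k))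
    choose τ η hη hxe using hx'
    -- The data on the blocks of each size are glued to data on all blocks.
    let f : B → B := fun b => (τ ⟨S.size b, b, rfl⟩ ⟨b, rfl⟩).1
    have hf : ∀ (k : Set.range S.size) (b : {b // S.size b = k}), f b.1 = τ k b := by
      rintro ⟨k, hk⟩ ⟨b, hb⟩
      dsimp only at hb
      subst hb
      rfl
    have hfs : ∀ b, S.size (f b) = S.size b := fun b =>
      (τ ⟨S.size b, b, rfl⟩ ⟨b, rfl⟩).2
    have hinj : Function.Injective f := fun b c hbc => by
      have hs : S.size c = S.size b := by rw [← hfs b, hbc, hfs]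
      have h1 := hf ⟨S.size b, b, rfl⟩ ⟨b, rfl⟩
      have h2 := hf ⟨S.size b, b, rfl⟩ ⟨c, hs⟩
      have := (τ _).injective (Subtype.ext (h1.symm.trans (hbc.trans h2)))
      exact congrArg Subtype.val this
    let η' : B → rootsOfUnity m ℂ := fun b => η ⟨S.size b, b, rfl⟩ ⟨b, rfl⟩
    have hη' : ∀ (k : Set.range S.size) (b : {b // S.size b = k}), η' b.1 = η k b := by
      rintro ⟨k, hk⟩ ⟨b, hb⟩
      dsimp only at hb
      subst hb
      rfl
    obtain ⟨g, hgH, hg⟩ := monomialMap_mem_map_reflectionPart e hS h₁ hH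
      (τ := Equiv.ofBijective f (Finite.injective_iff_bijective.1 hinj)) (η := η') hfs
      (fun k => by
        by_cases hk : k ∈ Set.range S.size
        · rw [prod_fiber_eq, ← hη ⟨k, hk⟩]
          congr 1
          exact Finset.prod_congr rfl fun b _ => hη' ⟨k, hk⟩ b
        · rw [Finset.prod_eq_one fun b hb => absurd ⟨b, by simpa using hb⟩ hk, one_pow])
    refine ⟨g, hgH, funext fun k => ?_⟩
    rw [hxe k]
    exact isotypicAction_eq e hS hg (hf k) (hη' k)

/-- With an initial part there is no constraint on the action on the fixed space, and every
complement is generated by reflections. -/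
theorem complement_of_init_nonempty (hS : S.IsNondegenerate m p) (hinit : S.init ≠ ∅)
    (hH : Subgroup.IsComplement' ((S.parabolic e m p).subgroupOf _) H) :
    H = reflectionPart (S.fixedAction e m p) H ∧
    (reflectionPart (S.fixedAction e m p) H).map
        (MonoidHom.pi fun k : Set.range S.size => isotypicAction e hS k) =
      Subgroup.pi Set.univ fun k : Set.range S.size =>
        monomialGroup (isotypicBasis e hS k) m 1 := by
  have hle : reflectionPart (S.fixedAction e m p) H ≤ H :=
    (Subgroup.closure_le _).2 fun _ h => h.1
  have h₂ : ∀ (η : B → rootsOfUnity m ℂ) k, (∏ b with S.size b = k, η b) ^ (m / 1) = 1 :=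
    fun η k => by rw [Nat.div_one, rootsOfUnity_pow_self]
  refine ⟨le_antisymm (fun x hx => ?_) hle,
    map_pi_reflectionPart (r := fun _ => 1) e hS (fun _ _ h => absurd h hinit)
      (fun _ _ _ η _ _ _ => h₂ η) hH⟩
  obtain ⟨σ, θ, τ, η, hθ, h, -, hga⟩ := exists_fixedAction_eq e hS x
  obtain ⟨y, hy, hyx⟩ := monomialMap_mem_map_reflectionPart (r := fun _ => 1) e hS
    (fun _ _ h => absurd h hinit) hH h.size_eq (h₂ η)
  rw [← hga] at hyx
  rwa [← (complement_ker _ (subgroupOf_parabolic_eq_ker e hS) hH).1 (hle hy) hx hyx]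

/-- Without an initial part, a diagonal reflection scales one block sum of size `k` by `z` with
`z ^ (k m / p) = 1`; this determines the groups generated by reflections. -/
theorem map_pi_reflectionPart_of_init_eq_empty (hp : p ∣ m) (hS : S.IsNondegenerate m p)
    (hinit : S.init = ∅)
    (hH : Subgroup.IsComplement' ((S.parabolic e m p).subgroupOf _) H) :
    (reflectionPart (S.fixedAction e m p) H).map
        (MonoidHom.pi fun k : Set.range S.size => isotypicAction e hS k) =
      Subgroup.pi Set.univ fun k : Set.range S.size =>
        monomialGroup (isotypicBasis e hS k) m (p / p.gcd k) := by
  have hm : 0 < m := Nat.pos_of_neZero m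
  refine map_pi_reflectionPart (r := fun k => p / p.gcd k) e hS (fun η hη _ => ?_)
    (fun σ θ τ η hθ h hrefl k => ?_) hH
  · rw [← Finset.prod_fiberwise_of_maps_to (g := S.size) (t := Finset.univ.image S.size)
      (fun b _ => Finset.mem_image_of_mem _ (Finset.mem_univ b)), ← Finset.prod_pow]
    refine Finset.prod_eq_one fun k _ => ?_
    have := (rootsOfUnity_pow_eq_one_iff hm hp k _).1 (hη k)
    rw [Finset.prod_congr rfl (g := fun b => η b ^ k) fun b hb => by
      rw [(Finset.mem_filter.1 hb).2], Finset.prod_pow, ← pow_mul, this]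
  · rcases hrefl.prod_fiber _ h.size_eq with ⟨a, ha⟩ | h1
    · have h2 := h.prod_pow_eq_one hinit hθ
      rw [Finset.prod_eq_single_of_mem a (Finset.mem_univ a)
        fun b _ hb => by rw [ha b hb, one_pow]] at h2
      by_cases hk : S.size a = k
      · rw [Finset.prod_eq_single_of_mem a (by simpa using hk) fun b _ hb => ha b hb,
          rootsOfUnity_pow_eq_one_iff hm hp, ← hk, pow_mul, h2]
      · rw [Finset.prod_eq_one fun b hb => ha b ?_, one_pow]
        rintro rfl
        exact hk (by simpa using hb)
    · rw [h1, one_pow]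

/-- Without an initial part, the image of a complement on `isotypic k` is determined by the
subgroup of `μ_m` formed by the possible products of the coefficients over the blocks of
size `k`. -/
theorem exists_map_isotypicAction_eq (hp : p ∣ m) (hS : S.IsNondegenerate m p)
    (hinit : S.init = ∅)
    (hH : Subgroup.IsComplement' ((S.parabolic e m p).subgroupOf _) H)
    (k : Set.range S.size) :
    ∃ q, q ∣ p / p.gcd k ∧
      H.map (isotypicAction e hS k) = monomialGroup (isotypicBasis e hS k) m q := by
  have hm : 0 < m := Nat.pos_of_neZero m
  let D : (B → rootsOfUnity m ℂ) →* rootsOfUnity m ℂ :=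
    { toFun := fun η => (∏ b, η b ^ S.size b) ^ (m / p)
      map_one' := by simp
      map_mul' := fun η η' => by simp [mul_pow, Finset.prod_mul_distrib] }
  let E : (B → rootsOfUnity m ℂ) →* rootsOfUnity m ℂ :=
    { toFun := fun η => ∏ b : {b // S.size b = k}, η b
      map_one' := by simp
      map_mul' := fun η η' => by simp [Finset.prod_mul_distrib] }
  obtain ⟨q, hq, hA⟩ := exists_dvd_mem_iff_pow_eq_one
    ((Nat.div_dvd_of_dvd (Nat.gcd_dvd_left p k)).trans hp) (D.ker.map E) (fun z hz => by
      obtain ⟨b, hb⟩ := k.2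
      refine ⟨Pi.mulSingle b z, ?_, ?_⟩
      · change (∏ x, (Pi.mulSingle b z : B → rootsOfUnity m ℂ) x ^ S.size x) ^ (m / p) = 1
        rw [Finset.prod_eq_single_of_mem b (Finset.mem_univ b)
          fun x _ hx => by rw [Pi.mulSingle_eq_of_ne hx, one_pow], Pi.mulSingle_eq_same,
          ← pow_mul, hb]
        exact (rootsOfUnity_pow_eq_one_iff hm hp k z).1 hz
      · change ∏ x : {b // S.size b = k}, (Pi.mulSingle b z : B → rootsOfUnity m ℂ) x = z
        rw [← prod_fiber_eq, prod_fiber_mulSingle, if_pos hb])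
  refine ⟨q, hq, le_antisymm ?_ ?_⟩
  · rintro _ ⟨x, -, rfl⟩
    obtain ⟨σ, θ, τ, η, hθ, h, -, hga⟩ := exists_fixedAction_eq e hS x
    obtain ⟨τ', hτ'⟩ := exists_isotypicAction_eq e hS h.size_eq hga k
    exact (mem_monomialGroup _).2 ⟨τ', _,
      (hA _).1 ⟨η, h.prod_pow_eq_one hinit hθ, rfl⟩, hτ'⟩
  · intro y hy
    obtain ⟨τ, ξ, hξ, rfl⟩ := (mem_monomialGroup _).1 hy
    -- An element of `H` acting diagonally, with the same product of coefficients, reduces the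
    -- claim to the group generated by reflections.
    obtain ⟨η, hη, hηξ⟩ := (hA _).2 hξ
    obtain ⟨g, hg⟩ := exists_fixedAction_eq_monomialMap e hS 1 η (fun _ => rfl) fun _ => hη
    obtain ⟨x, hx, hxg⟩ := (complement_ker _ (subgroupOf_parabolic_eq_ker e hS) hH).2 g
    rw [hg] at hxg
    have hxk : isotypicAction e hS k x =
        monomialMap (isotypicBasis e hS k) 1 (fun b => η b.1) :=
      isotypicAction_eq e hS hxg (fun _ => rfl) fun _ => rfl
    have hmem : (isotypicAction e hS k x)⁻¹ * monomialMap (isotypicBasis e hS k) τ ξ ∈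
        monomialGroup (isotypicBasis e hS k) m (p / p.gcd k) := by
      rw [hxk, monomialMap_inv, monomialMap_mul, inv_one]
      refine (mem_monomialGroup _).2 ⟨_, _, ?_, rfl⟩
      simp only [Equiv.Perm.one_apply]
      rw [Finset.prod_mul_distrib, Equiv.prod_comp τ (fun b => (η b.1)⁻¹),
        Finset.prod_inv_distrib, ← hηξ]
      change ((E η)⁻¹ * E η) ^ _ = 1
      rw [inv_mul_cancel, one_pow]
    rw [← map_isotypicAction e hS _ (map_pi_reflectionPart_of_init_eq_empty e hp hS hinit hH) k]
      at hmem
    obtain ⟨w, hw, hwe⟩ := hmem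
    have hle : reflectionPart (S.fixedAction e m p) H ≤ H :=
      (Subgroup.closure_le _).2 fun _ h => h.1
    refine ⟨x * w, H.mul_mem hx (hle hw), ?_⟩
    rw [map_mul, hwe, mul_inv_cancel_left]

end Action

/-! ### An initial part with one element -/

/-- An initial part with a single element, regarded as an additional block. -/
def absorbInit {ι B : Type*} [DecidableEq B] (S : BlockSystem ι B) {a : ι} (ha : S.init = {a}) :
    BlockSystem ι (Option B) where
  init := ∅
  block o := o.elim S.init S.block
  label j := some (S.label j)
  pos j := if S.label j = none then 0 else S.pos j
  size o := o.elim 1 S.size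
  mem_init := by simp
  mem_block {o j} := by
    cases o with
    | none => simp [S.mem_init]
    | some b => simp [S.mem_block]
  pos_inj {i j} hl hp := by
    rw [Option.some_inj] at hl
    by_cases h : S.label j = none
    · have h1 := S.mem_init.2 h
      have h2 := S.mem_init.2 (hl.trans h)
      rw [ha, Finset.mem_singleton] at h1 h2
      rw [h1, h2]
    · rw [if_neg h, if_neg (hl ▸ h)] at hp
      exact S.pos_inj hl hp
  size_pos o := by
    cases o with
    | none => exact one_pos
    | some b => exact S.size_pos b
  lt_size_iff {o x} := by
    simp only [Option.some_inj]
    cases o with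
    | none =>
      have hla : S.label a = none := S.mem_init.1 (by simp [ha])
      simp only [Option.elim_none, Nat.lt_one_iff]
      constructor
      · rintro rfl
        exact ⟨a, hla, by simp [hla]⟩
      · rintro ⟨j, hj, hx⟩
        rw [← hx, if_pos hj]
    | some b =>
      simp only [Option.elim_some, S.lt_size_iff]
      refine exists_congr fun j => and_congr_right fun hj => ?_
      simp [hj]

/-- For `p = m` the group `G(m,p,1)` is trivial, so that the parabolic subgroup does not change
when an initial part with one element becomes an additional block. -/
theorem parabolic_absorbInit {V : Type*} [AddCommGroup V] [Module ℂ V] {ι B : Type*} [Fintype ι]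
    [DecidableEq ι] [DecidableEq B] (S : BlockSystem ι B) {a : ι} (ha : S.init = {a})
    (e : Module.Basis ι ℂ V) {m : ℕ} (hm : 0 < m) :
    (S.absorbInit ha).parabolic e m m = S.parabolic e m m := by
  ext g
  rw [mem_parabolic, mem_parabolic]
  refine exists₂_congr fun σ θ => and_congr_right fun hθ => ?_
  rw [Nat.div_self hm, pow_one] at hθ
  refine and_congr (forall_congr' fun i => ?_) (and_congr_left fun _ => ?_)
  · simp [absorbInit]
  · refine ⟨fun h i _ => h i (by simp [absorbInit]), fun h => ?_⟩
    have h1 : ∀ i, i ≠ a → θ i = 1 := fun i hi => h i fun hl =>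
      hi (by simpa [ha] using S.mem_init.2 hl)
    rw [Finset.prod_eq_single_of_mem a (Finset.mem_univ a) fun i _ hi => h1 i hi] at hθ
    intro i _
    by_cases hi : i = a
    · rw [hi, hθ]
    · exact h1 i hi

end BlockSystem

/-! ### The standard block system -/

section Standard

variable {n d : ℕ}

theorem partialSum_succ (n₀ : ℕ) (lam : Fin d → ℕ) (i : Fin d) :
    partialSum n₀ lam (i.val + 1) = partialSum n₀ lam i.val + lam i := by
  have : Finset.univ.filter (fun l : Fin d => l.val < i.val + 1) =
      insert i (Finset.univ.filter fun l : Fin d => l.val < i.val) := by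
    ext l
    simp [Fin.ext_iff]
    omega
  rw [partialSum, this, Finset.sum_insert (by simp), partialSum]
  ring

theorem partialSum_mono (n₀ : ℕ) (lam : Fin d → ℕ) : Monotone (partialSum n₀ lam) := by
  intro i j hij
  refine Nat.add_le_add_left (Finset.sum_le_sum_of_subset fun l hl => ?_) _
  simp only [Finset.mem_filter, Finset.mem_univ, true_and] at hl ⊢
  omega

theorem partialSum_le (n₀ : ℕ) (lam : Fin d → ℕ) (i : ℕ) :
    partialSum n₀ lam i ≤ n₀ + ∑ l, lam l :=
  Nat.add_le_add_left (Finset.sum_le_sum_of_subset (Finset.filter_subset _ _)) _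

theorem block_disjoint {n₀ : ℕ} {lam : Fin d → ℕ} {i i' : Fin d} {j : Fin n}
    (h : j ∈ block n n₀ lam i) (h' : j ∈ block n n₀ lam i') : i = i' := by
  simp only [block, Finset.mem_filter, Finset.mem_univ, true_and] at h h'
  rcases lt_trichotomy i i' with hlt | heq | hlt
  · have := partialSum_mono n₀ lam (show i.val + 1 ≤ i'.val from hlt)
    omega
  · exact heq
  · have := partialSum_mono n₀ lam (show i'.val + 1 ≤ i.val from hlt)
    omega

theorem exists_mem_block_iff {n₀ : ℕ} {lam : Fin d → ℕ} (hsum : n₀ + ∑ i, lam i = n)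
    {j : Fin n} : (∃ i, j ∈ block n n₀ lam i) ↔ n₀ ≤ j.val := by
  constructor
  · rintro ⟨i, hi⟩
    simp only [block, Finset.mem_filter, Finset.mem_univ, true_and] at hi
    exact (Nat.le_add_right _ _).trans hi.1
  · intro hj
    have hd : j.val < partialSum n₀ lam d := by
      rw [partialSum, Finset.filter_true_of_mem fun l _ => l.2, hsum]
      exact j.2
    have hex : ∃ t, j.val < partialSum n₀ lam t := ⟨d, hd⟩
    classical
    have h0 : Nat.find hex ≠ 0 := fun h => by
      have := Nat.find_spec hex
      rw [h] at this
      simp [partialSum] at this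
      omega
    have hle : Nat.find hex ≤ d := Nat.find_min' hex hd
    refine ⟨⟨Nat.find hex - 1, by omega⟩, ?_⟩
    simp only [block, Finset.mem_filter, Finset.mem_univ, true_and]
    refine ⟨not_lt.1 (Nat.find_min hex (by omega)), ?_⟩
    rw [Nat.sub_add_cancel (by omega)]
    exact Nat.find_spec hex

/-- The block containing an index, or `none` for the initial block. -/
noncomputable def blockLabel (n₀ : ℕ) (lam : Fin d → ℕ) (j : Fin n) : Option (Fin d) := by
  classical
  exact if h : ∃ i, j ∈ block n n₀ lam i then some h.choose else none

theorem mem_block_iff_blockLabel {n₀ : ℕ} {lam : Fin d → ℕ} {i : Fin d} {j : Fin n} :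
    j ∈ block n n₀ lam i ↔ blockLabel n₀ lam j = some i := by
  unfold blockLabel
  split_ifs with h
  · rw [Option.some_inj]
    exact ⟨fun h' => block_disjoint h.choose_spec h', fun h' => h' ▸ h.choose_spec⟩
  · simpa using fun h' => h ⟨i, h'⟩

theorem mem_block₀_iff_blockLabel {n₀ : ℕ} {lam : Fin d → ℕ} (hsum : n₀ + ∑ i, lam i = n)
    {j : Fin n} : j ∈ block₀ n n₀ ↔ blockLabel n₀ lam j = none := by
  rw [Option.eq_none_iff_forall_ne_some]
  simp only [ne_eq, ← mem_block_iff_blockLabel, ← not_exists, exists_mem_block_iff hsum]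
  simp [block₀]

/-- The blocks of the standard parabolic subgroup of type `(n₀, lam)`, each enumerated in
increasing order. -/
noncomputable def standardSystem {n₀ : ℕ} {lam : Fin d → ℕ} (hpos : ∀ i, 0 < lam i)
    (hsum : n₀ + ∑ i, lam i = n) : BlockSystem (Fin n) (Fin d) where
  init := block₀ n n₀
  block := block n n₀ lam
  label := blockLabel n₀ lam
  pos j := j.val - (blockLabel n₀ lam j).elim 0 fun i => partialSum n₀ lam i.val
  size := lam
  mem_init := mem_block₀_iff_blockLabel hsum
  mem_block := mem_block_iff_blockLabel
  pos_inj {i j} hl hp := by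
    rw [hl] at hp
    cases h : blockLabel n₀ lam j with
    | none =>
      rw [h] at hp
      exact Fin.ext (by simpa using hp)
    | some b =>
      have h1 := mem_block_iff_blockLabel.2 h
      have h2 := mem_block_iff_blockLabel.2 (hl.trans h)
      simp only [block, Finset.mem_filter, Finset.mem_univ, true_and] at h1 h2
      rw [h] at hp
      simp only [Option.elim_some] at hp
      exact Fin.ext (by omega)
  size_pos := hpos
  lt_size_iff {b x} := by
    have hb := partialSum_succ n₀ lam b
    constructor
    · intro hx
      have hlt : partialSum n₀ lam b.val + x < n := by
        have := partialSum_le n₀ lam (b.val + 1)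
        omega
      have hmem : (⟨_, hlt⟩ : Fin n) ∈ block n n₀ lam b := by
        simp only [block, Finset.mem_filter, Finset.mem_univ, true_and]
        omega
      refine ⟨⟨_, hlt⟩, mem_block_iff_blockLabel.1 hmem, ?_⟩
      rw [mem_block_iff_blockLabel.1 hmem]
      simp
    · rintro ⟨j, hj, rfl⟩
      have h1 := mem_block_iff_blockLabel.2 hj
      simp only [block, Finset.mem_filter, Finset.mem_univ, true_and] at h1
      rw [hj, Option.elim_some]
      omega

/-- If `G(m,p,n₀)` is not the trivial group acting on a line, it has enough diagonal elements to
move every basis vector: multiples of one basis vector if `p ≠ m`, and elements `diag(u, u⁻¹)`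
if `p = m` and `n₀ ≥ 2`. -/
theorem isNondegenerate_standardSystem {n₀ m p : ℕ} {lam : Fin d → ℕ} (hpos : ∀ i, 0 < lam i)
    (hsum : n₀ + ∑ i, lam i = n) (hm : 0 < m) (hp : p ∣ m) (hm₁ : m = 1 → n₀ = 0)
    (h : n₀ = 1 → p ≠ m) : (standardSystem (n := n) hpos hsum).IsNondegenerate m p := by
  intro j hj
  have hj' : j.val < n₀ := by
    simpa [standardSystem, block₀] using (standardSystem (n := n) hpos hsum).mem_init.2 hj
  have : NeZero m := ⟨hm.ne'⟩
  obtain ⟨u, hu⟩ := exists_rootsOfUnity_orderOf_eq m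
  by_cases hpm : p = m
  · subst hpm
    have hu1 : u ≠ 1 := fun h1 => by
      rw [h1, orderOf_one] at hu
      have := hm₁ hu.symm
      omega
    have hn : n₀ ≠ 1 := fun h1 => h h1 rfl
    obtain ⟨j', hjj', hlt⟩ : ∃ j' : Fin n, j' ≠ j ∧ j'.val < n₀ := by
      by_cases h0 : j.val = 0
      · exact ⟨⟨1, by omega⟩, fun h => by simp [← h] at h0, by simp; omega⟩
      · exact ⟨⟨0, by omega⟩, fun h => by simp [← h] at h0, by simp; omega⟩
    have hl' : (standardSystem (n := n) hpos hsum).label j' = none :=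
      BlockSystem.mem_init _ |>.1 (by simpa [standardSystem, block₀] using hlt)
    refine ⟨Pi.mulSingle j u * Pi.mulSingle j' u⁻¹, fun i hi => ?_, ?_, ?_⟩
    · have h1 : i ≠ j := fun h => hi (h ▸ hj)
      have h2 : i ≠ j' := fun h => hi (h ▸ hl')
      simp [h1, h2]
    · simp only [Pi.mul_apply, Finset.prod_mul_distrib, Finset.prod_pi_mulSingle',
        Finset.mem_univ, if_true, mul_inv_cancel, one_pow]
    · simpa [hjj'.symm] using hu1
  · have hp0 : 0 < p := Nat.pos_of_dvd_of_pos hp hm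
    have hlt : p < m := lt_of_le_of_ne (Nat.le_of_dvd hm hp) hpm
    refine ⟨Pi.mulSingle j (u ^ p), fun i hi => ?_, ?_, ?_⟩
    · rw [Pi.mulSingle_eq_of_ne]
      rintro rfl
      exact hi hj
    · rw [Finset.prod_pi_mulSingle', if_pos (Finset.mem_univ _), ← pow_mul,
        Nat.mul_div_cancel' hp, rootsOfUnity_pow_self]
    · rw [Pi.mulSingle_eq_same]
      exact pow_ne_one_of_lt_orderOf hp0.ne' (hu.symm ▸ hlt)

end Standard

end ImprimitiveReflection

theorem mainTheorem2 {V : Type*} [NormedAddCommGroup V] [InnerProductSpace ℂ V]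
    (m p n : ℕ) (hm : 0 < m) (hp : p ∣ m) (e : OrthonormalBasis (Fin n) ℂ V)
    (n₀ d : ℕ) (hn₀ : n₀ < n) (lam : Fin d → ℕ) (hpos : ∀ i, 0 < lam i) (hlam : Antitone lam)
    (hsum : n₀ + ∑ i, lam i = n) (hm₁ : m = 1 → n₀ = 0) :
    let G := ImprimitiveReflection.monomialGroup e.toBasis m p
    let P := ImprimitiveReflection.standardParabolic e.toBasis m p n₀ lam
    let N := ImprimitiveReflection.normalizerIn G P
    let U := ImprimitiveReflection.fixedSpace P
    let X : Set.range lam → Submodule ℂ V := fun k =>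
      ImprimitiveReflection.isotypicFixed e.toBasis m p n₀ lam k
    (∃ H : Subgroup N, Subgroup.IsComplement' (P.subgroupOf N) H) ∧
    ((n₀ = 1 → p ≠ m) →
      DirectSum.IsInternal (fun k => (X k).submoduleOf U) ∧
      ∃ β : ∀ k : Set.range lam, Module.Basis {i : Fin d // lam i = k} ℂ (X k),
      (∀ k i, (β k i : V) = ∑ j ∈ ImprimitiveReflection.block n n₀ lam i, e j) ∧
      ∃ (hU : N ≤ ImprimitiveReflection.setStabilizer U)
        (hX : ∀ k, N ≤ ImprimitiveReflection.setStabilizer (X k)),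
      let ρ : N →* (U ≃ₗ[ℂ] U) := ImprimitiveReflection.restriction hU
      let φ : ∀ k, N →* (X k ≃ₗ[ℂ] X k) := fun k => ImprimitiveReflection.restriction (hX k)
      ∀ H : Subgroup N, Subgroup.IsComplement' (P.subgroupOf N) H →
        let H₀ := ImprimitiveReflection.reflectionPart ρ H
        (n₀ ≠ 0 →
          (∀ k, H.map (φ k) = ImprimitiveReflection.monomialGroup (β k) m 1) ∧
          H = H₀ ∧
          Set.InjOn ρ H ∧
          H.map (MonoidHom.pi φ) =
            Subgroup.pi Set.univ (fun k => ImprimitiveReflection.monomialGroup (β k) m 1)) ∧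
        (n₀ = 0 →
          (∀ k, H₀.map (φ k) =
            ImprimitiveReflection.monomialGroup (β k) m (p / Nat.gcd p k)) ∧
          Set.InjOn ρ H₀ ∧
          H₀.map (MonoidHom.pi φ) =
            Subgroup.pi Set.univ
              (fun k => ImprimitiveReflection.monomialGroup (β k) m (p / Nat.gcd p k)) ∧
          ∀ k : Set.range lam, ∃ q, q ∣ p / Nat.gcd p k ∧
            H.map (φ k) = ImprimitiveReflection.monomialGroup (β k) m q)) := by
  intro G P N U X
  have hne : NeZero m := ⟨hm.ne'⟩
  have hnon : Nonempty (Fin n) := ⟨⟨n₀, hn₀⟩⟩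
  let S := ImprimitiveReflection.standardSystem (n := n) hpos hsum
  constructor
  · -- For `n₀ = 1` and `p = m` the first factor of `P` is trivial, and `Λ₀` is a block of size `1`.
    by_cases hdeg : n₀ = 1 ∧ p = m
    · obtain ⟨rfl, rfl⟩ := hdeg
      have ha : S.init = {⟨0, by omega⟩} := by
        ext j
        simp [S, ImprimitiveReflection.standardSystem, ImprimitiveReflection.block₀, Fin.ext_iff]
      -- The condition is vacuous: no index has the label `none` any more.
      have key := (S.absorbInit ha).exists_isComplement' e.toBasis (m := p) (p := p)
        fun j hj => absurd hj (Option.some_ne_none _)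
      rw [S.parabolic_absorbInit ha e.toBasis hm] at key
      exact key
    · exact S.exists_isComplement' e.toBasis
        (ImprimitiveReflection.isNondegenerate_standardSystem hpos hsum hm hp hm₁
          fun h1 h2 => hdeg ⟨h1, h2⟩)
  · intro h
    have hS : S.IsNondegenerate m p :=
      ImprimitiveReflection.isNondegenerate_standardSystem hpos hsum hm hp hm₁ h
    refine ⟨S.isInternal_isotypic e.toBasis hS, fun k => S.isotypicBasis e.toBasis hS k,
      fun k i => ?_, S.normalizer_le_stabilizer e.toBasis m p,
      fun k => S.normalizer_le_stabilizer_isotypic e.toBasis hS k, ?_⟩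
    · refine (S.coe_isotypicBasis e.toBasis hS k i).trans ?_
      simp only [ImprimitiveReflection.BlockSystem.blockSum, OrthonormalBasis.coe_toBasis]
      rfl
    intro ρ φ H hH H₀
    have hle : H₀ ≤ H := (Subgroup.closure_le _).2 fun _ h => h.1
    have hinj : Set.InjOn ρ H := (ImprimitiveReflection.complement_ker _
      (S.subgroupOf_parabolic_eq_ker e.toBasis hS) hH).1
    constructor
    · intro h0
      have hinit : S.init ≠ ∅ := Finset.nonempty_iff_ne_empty.1
        ⟨⟨0, by omega⟩, by
          simp [S, ImprimitiveReflection.standardSystem, ImprimitiveReflection.block₀]; omega⟩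
      obtain ⟨h1, h2⟩ := S.complement_of_init_nonempty e.toBasis hS hinit hH
      rw [← h1] at h2
      exact ⟨S.map_isotypicAction e.toBasis hS H h2, h1, hinj, h2⟩
    · intro h0
      have hinit : S.init = ∅ := by
        simp [S, ImprimitiveReflection.standardSystem, ImprimitiveReflection.block₀, h0]
      have h2 := S.map_pi_reflectionPart_of_init_eq_empty e.toBasis hp hS hinit hH
      exact ⟨S.map_isotypicAction e.toBasis hS H₀ h2, hinj.mono hle, h2,
        S.exists_map_isotypicAction_eq e.toBasis hp hS hinit hH⟩
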